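/- Let $M$ be a finite monoid with set of idempotents $E(M)$. For $m,n\in M$ write $m\mathrel{\mathscr L}n$, $m\mathrel{\mathscr R}n$, $m\mathrel{\mathscr J}n$ if $Mm=Mn$, $mM=nM$, $MmM=MnM$, respectively, and write $m\mathrel{\widetilde{\mathscr L}}n$ if for every $f\in E(M)$ one has $mf=m\iff nf=n$. Denote by $L_m,R_m,J_m,\widetilde L_m$ the corresponding classes of $m$. Assume that $M$ is right Fountain, that is, every $\widetilde{\mathscr L}$-class of $M$ contains an idempotent. For $e\in E(M)$ let $G_e$ be the group of units of the monoid $eMe$ (the maximal subgroup at $e$), and let $\Bbbk$ be a field whose characteristic does not divide the order of any maximal subgroup of $M$. For $e\in E(M)$: - Let $A$ and $B$ be the sets of $\mathscr R$-classes and of $\mathscr L$-classes contained in $J_e$, and choose $\rho_a\in L_e\cap a$ for $a\in A$ and $\lambda_b\in R_e\cap b$ for $b\in B$. The corresponding sandwich matrix of $J_e$ is the $B\times A$ matrix $P$ over $\Bbbk G_e$ with $P(b,a)=\lambda_b\rho_a$ if $\lambda_b\rho_a\in G_e$ and $P(b,a)=0$ otherwise. - For a $\Bbbk G_e$-module $V$,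 $\mathrm{Coind}_{G_e}(V)=\mathrm{Hom}_{G_e}(R_e,V)$ is the space of $G_e$-equivariant maps $f\colon R_e\to V$, a $\Bbbk M$-module via $(mf)(r)=f(rm)$ if $rm\in R_e$ and $(mf)(r)=0$ otherwise. If $V$ is simple, $V^\sharp$ is the socle of $\mathrm{Coind}_{G_e}(V)$; it is the simple $\Bbbk M$-module associated to $V$. - $\Bbbk\widetilde L_e$ is the $\Bbbk M$-$\Bbbk G_e$-bimodule with basis $\widetilde L_e$, where $m\in M$ sends $x\in\widetilde L_e$ to $mx$ if $mx\in\widetilde L_e$ and to $0$ otherwise, and $G_e$ acts by right multiplication. Let $e_1,\dots,e_n$ be idempotents of $M$, exactly one in each $\mathscr J$-class of $M$ that contains an idempotent. Then the following are equivalent. 1. For $i=1,\dots,n$, each sandwich matrix of $J_{e_i}$ is right invertible over $\Bbbk G_{e_i}$. 2. For $i=1,\dots,n$ and each simple $\Bbbk G_{e_i}$-module $V$, the $\Bbbk M$-module $\mathrm{Coind}_{G_{e_i}}(V)$ is simple. 3. For $i=1,\dots,n$ and each simple $\Bbbk G_{e_i}$-module $V$, the projective cover of the simple $\Bbbk M$-module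 $V^\sharp$ is $\Bbbk\widetilde L_{e_i}\otimes_{\Bbbk G_{e_i}}V$; that is, this module is finite dimensional and projective and has a surjective homomorphism onto $V^\sharp$ whose kernel is contained in its radical. -/

import Mathlib

open scoped TensorProduct MonoidAlgebra

universe u v w x

namespace FountainMonoid

/-! ### Idempotents, Green's relations, maximal subgroups -/

section Green

variable {M : Type u} [Monoid M]

/-- Green's relation `L`: the principal left ideals `Mm` and `Mn` coincide. -/
def LRel (m n : M) : Prop := {x : M | ∃ a, x = a * m} = {x : M | ∃ a, x = a * n}

/-- Green's relation `R`: the principal right ideals `mM` and `nM` coincide. -/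
def RRel (m n : M) : Prop := {x : M | ∃ a, x = m * a} = {x : M | ∃ a, x = n * a}

/-- Green's relation `J`: the principal two-sided ideals `MmM` and `MnM` coincide. -/
def JRel (m n : M) : Prop :=
  {x : M | ∃ a b, x = a * m * b} = {x : M | ∃ a b, x = a * n * b}

/-- The relation `L̃`: `m` and `n` have the same idempotent right identities. -/
def LTildeRel (m n : M) : Prop := ∀ f : M, IsIdempotentElem f → (m * f = m ↔ n * f = n)

variable (M)

/-- The type `E(M)` of idempotents of `M`. -/
abbrev Idem : Type u := {e : M // IsIdempotentElem e}

/-- A monoid is right Fountain if each `L̃`-class contains an idempotent. -/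
class IsRightFountain : Prop where
  exists_idem : ∀ m : M, ∃ e : M, IsIdempotentElem e ∧ LTildeRel e m

variable {M}

/-- The local monoid `eMe = {x | ex = x = xe}`. -/
@[ext]
structure LocalMonoid (e : Idem M) : Type u where
  val : M
  left_id : (e : M) * val = val
  right_id : val * (e : M) = val

/-- `eMe` is a monoid with identity `e`. -/
instance (e : Idem M) : Monoid (LocalMonoid e) where
  mul x y := ⟨x.val * y.val, by rw [← mul_assoc, x.left_id], by rw [mul_assoc, y.right_id]⟩
  mul_assoc x y z := LocalMonoid.ext (mul_assoc x.val y.val z.val)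
  one := ⟨e, e.2, e.2⟩
  one_mul x := LocalMonoid.ext x.left_id
  mul_one x := LocalMonoid.ext x.right_id

/-- The maximal subgroup `G_e`: the group of units of `eMe`. -/
abbrev MaxSubgroup (e : Idem M) : Type u := (LocalMonoid e)ˣ

/-- The underlying element of `M` of an element of `G_e`. -/
def MaxSubgroup.val {e : Idem M} (g : MaxSubgroup e) : M := (g : LocalMonoid e).val

namespace MaxSubgroup

variable {e : Idem M}

@[simp] theorem val_one : (1 : MaxSubgroup e).val = e := rfl

@[simp] theorem val_mul (g h : MaxSubgroup e) : (g * h).val = g.val * h.val := rfl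

theorem left_id (g : MaxSubgroup e) : (e : M) * g.val = g.val := LocalMonoid.left_id _

theorem right_id (g : MaxSubgroup e) : g.val * (e : M) = g.val := LocalMonoid.right_id _

theorem mul_inv_val (g : MaxSubgroup e) : g.val * (g⁻¹).val = e := by
  rw [← val_mul, mul_inv_cancel, val_one]

theorem inv_mul_val (g : MaxSubgroup e) : (g⁻¹).val * g.val = e := by
  rw [← val_mul, inv_mul_cancel, val_one]

end MaxSubgroup

end Green

/-! ### Sandwich matrices -/

section Sandwich

variable {M : Type u} [Monoid M]

/-- The set of `R`-classes contained in the `J`-class of `e`. -/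
abbrev RClassesIn (e : Idem M) : Type u :=
  {A : Set M // ∃ m : M, JRel m e ∧ A = {x | RRel x m}}

/-- The set of `L`-classes contained in the `J`-class of `e`. -/
abbrev LClassesIn (e : Idem M) : Type u :=
  {B : Set M // ∃ m : M, JRel m e ∧ B = {x | LRel x m}}

noncomputable instance [Finite M] (e : Idem M) : Fintype (RClassesIn e) := Fintype.ofFinite _

noncomputable instance (e : Idem M) : DecidableEq (LClassesIn e) := Classical.decEq _

/-- A choice of representatives `ρ_a ∈ L_e ∩ a` of the `R`-classes `a` of `J_e` and
`lam_b ∈ R_e ∩ b` of the `L`-classes `b` of `J_e`. -/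
structure SandwichReps (e : Idem M) where
  rho : RClassesIn e → M
  rho_mem : ∀ a, rho a ∈ a.1
  rho_LRel : ∀ a, LRel (rho a) e
  lam : LClassesIn e → M
  lam_mem : ∀ b, lam b ∈ b.1
  lam_RRel : ∀ b, RRel (lam b) e

open Classical in
/-- The sandwich matrix of `J_e` for the given representatives, as a matrix over `kG_e`: the
`(b, a)` entry is `lam_b * ρ_a` if this lies in `G_e`, and `0` otherwise. -/
noncomputable def sandwichMatrix (k : Type v) [Field k] {e : Idem M} (s : SandwichReps e) :
    Matrix (LClassesIn e) (RClassesIn e) k[MaxSubgroup e] := fun b a =>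
  if h : ∃ g : MaxSubgroup e, g.val = s.lam b * s.rho a then MonoidAlgebra.single h.choose 1
  else 0

/-- A (rectangular) matrix over a ring is right invertible if it has a right inverse. -/
def IsRightInvertible {R : Type*} [Ring R] {B A : Type*} [Fintype A] [DecidableEq B]
    (P : Matrix B A R) : Prop := ∃ Q : Matrix A B R, P * Q = 1

end Sandwich

/-! ### Coinduced modules -/

section Coind

variable {M : Type u} [Monoid M]

/-- The `R`-class `R_e` of an idempotent. -/
abbrev RClass (e : Idem M) : Type u := {r : M // RRel r e}

theorem rRel_iff {m n : M} : RRel m n ↔ (∃ a, m = n * a) ∧ ∃ a, n = m * a := by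
  constructor
  · intro h
    exact ⟨h.subset ⟨1, (mul_one m).symm⟩, h.superset ⟨1, (mul_one n).symm⟩⟩
  · rintro ⟨⟨a, ha⟩, ⟨b, hb⟩⟩
    ext x
    constructor
    · rintro ⟨c, rfl⟩; exact ⟨a * c, by rw [← mul_assoc, ← ha]⟩
    · rintro ⟨c, rfl⟩; exact ⟨b * c, by rw [← mul_assoc, ← hb]⟩

variable {e : Idem M}

theorem RClass.left_id (r : RClass e) : (e : M) * r.1 = r.1 := by
  obtain ⟨⟨a, ha⟩, -⟩ := rRel_iff.mp r.2
  rw [ha, ← mul_assoc, e.2]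

/-- `G_e` acts on the left of `R_e` by left multiplication. -/
instance : MulAction (MaxSubgroup e) (RClass e) where
  smul g r := ⟨g.val * r.1, by
    obtain ⟨⟨a, ha⟩, ⟨b, hb⟩⟩ := rRel_iff.mp r.2
    refine rRel_iff.mpr ⟨⟨g.val * r.1, ?_⟩, ⟨b * (g⁻¹).val, ?_⟩⟩
    · rw [← mul_assoc, g.left_id]
    · rw [mul_assoc g.val, ← mul_assoc r.1, ← hb, ← mul_assoc, g.right_id, g.mul_inv_val]⟩
  one_smul r := Subtype.ext r.left_id
  mul_smul g h r := Subtype.ext (mul_assoc g.val h.val r.1)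

theorem RClass.smul_val (g : MaxSubgroup e) (r : RClass e) : (g • r).1 = g.val * r.1 := rfl

theorem RClass.of_mul {r m n : M} (hr : RRel r e) (h : RRel (r * (m * n)) e) :
    RRel (r * m) e := by
  obtain ⟨⟨a, ha⟩, -⟩ := rRel_iff.mp hr
  obtain ⟨-, ⟨b, hb⟩⟩ := rRel_iff.mp h
  exact rRel_iff.mpr ⟨⟨a * m, by rw [← mul_assoc, ← ha]⟩, ⟨n * b, by
    rw [hb]; simp only [mul_assoc]⟩⟩

theorem RClass.smul_mul_iff (g : MaxSubgroup e) (r : RClass e) (m : M) :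
    RRel ((g • r).1 * m) e ↔ RRel (r.1 * m) e := by
  constructor
  · intro h
    have h1 := (g⁻¹ • (⟨_, h⟩ : RClass e)).2
    have h2 : (g⁻¹).val * (g.val * r.1 * m) = r.1 * m := by
      rw [← mul_assoc, ← mul_assoc, g.inv_mul_val, r.left_id]
    exact h2 ▸ h1
  · intro h
    have := (g • (⟨_, h⟩ : RClass e)).2
    rw [RClass.smul_val, ← mul_assoc] at this
    exact this

variable {k : Type v} [Field k] {V : Type w} [AddCommGroup V] [Module k V]

/-- The space `Hom_{G_e}(R_e, V)` of `G_e`-equivariant maps `R_e → V`. -/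
def coindV (e : Idem M) (σ : Representation k (MaxSubgroup e) V) :
    Submodule k (RClass e → V) where
  carrier := {f | ∀ (g : MaxSubgroup e) (r : RClass e), f (g • r) = σ g (f r)}
  add_mem' hf hf' g r := by simp [hf g r, hf' g r]
  zero_mem' g r := by simp
  smul_mem' c f hf g r := by simp [hf g r]

/-- The vector space underlying `Coind_{G_e}(V)`. -/
def CoindSpace (e : Idem M) (σ : Representation k (MaxSubgroup e) V) : Type _ := coindV e σ

instance (e : Idem M) (σ : Representation k (MaxSubgroup e) V) : AddCommGroup (CoindSpace e σ) :=
  inferInstanceAs (AddCommGroup (coindV e σ))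

instance (e : Idem M) (σ : Representation k (MaxSubgroup e) V) : Module k (CoindSpace e σ) :=
  inferInstanceAs (Module k (coindV e σ))

open Classical in
/-- The action of `m ∈ M` on `Hom_{G_e}(R_e, V)`: it sends `f` to the map `r ↦ f (r * m)` if
`r * m ∈ R_e`, and `r ↦ 0` otherwise. -/
noncomputable def coindAct (e : Idem M) (σ : Representation k (MaxSubgroup e) V) (m : M) :
    coindV e σ →ₗ[k] coindV e σ where
  toFun f := ⟨fun r => if h : RRel (r.1 * m) e then f.1 ⟨r.1 * m, h⟩ else 0, by
    intro g r
    dsimp only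
    by_cases h : RRel (r.1 * m) e
    · have h' := (RClass.smul_mul_iff g r m).mpr h
      rw [dif_pos h, dif_pos h', ← f.2 g ⟨_, h⟩]
      exact congrArg f.1 (Subtype.ext (mul_assoc g.val r.1 m))
    · have h' := (RClass.smul_mul_iff g r m).not.mpr h
      rw [dif_neg h, dif_neg h', map_zero]⟩
  map_add' f f' := by
    ext r
    by_cases h : RRel (r.1 * m) e <;> simp [h]
  map_smul' c f := by
    ext r
    by_cases h : RRel (r.1 * m) e <;> simp [h]

open Classical in
/-- The coinduced module `Coind_{G_e}(V) = Hom_{G_e}(R_e, V)`. -/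
noncomputable def coind (e : Idem M) (σ : Representation k (MaxSubgroup e) V) :
    Representation k M (CoindSpace e σ) where
  toFun m := (coindAct e σ m : coindV e σ →ₗ[k] coindV e σ)
  map_one' := by
    refine LinearMap.ext fun f => Subtype.ext (funext fun r => ?_)
    change (if h : RRel (r.1 * 1) e then f.1 ⟨r.1 * 1, h⟩ else 0) = f.1 r
    simp [r.2]
  map_mul' m n := by
    refine LinearMap.ext fun f => Subtype.ext (funext fun r => ?_)
    change (if h : RRel (r.1 * (m * n)) e then f.1 ⟨r.1 * (m * n), h⟩ else 0) =
      if h : RRel (r.1 * m) e then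
        (if h' : RRel (r.1 * m * n) e then f.1 ⟨r.1 * m * n, h'⟩ else 0) else 0
    by_cases h : RRel (r.1 * (m * n)) e
    · have h1 := RClass.of_mul r.2 h
      simp [h, h1, mul_assoc]
    · have h2 : ¬ RRel (r.1 * m * n) e := by rw [mul_assoc]; exact h
      simp [h, h2]

end Coind

/-! ### The simple module `V^♯` and projective covers -/

section Modules

/-- The socle of a module: the submodule generated by all simple submodules. -/
def socle (R : Type u) [Ring R] (N : Type v) [AddCommGroup N] [Module R N] : Submodule R N :=
  sSup {S : Submodule R N | IsSimpleModule R S}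

/-- `P` is a projective cover of `N`: it is finitely generated and projective, and there is a
surjective homomorphism `P → N` with kernel contained in the radical of `P` (the intersection of
the maximal submodules of `P`). -/
def IsProjectiveCover (R : Type u) [Ring R] (P : Type v) [AddCommGroup P] [Module R P]
    (N : Type w) [AddCommGroup N] [Module R N] : Prop :=
  Module.Finite R P ∧ Module.Projective R P ∧
    ∃ ψ : P →ₗ[R] N, Function.Surjective ψ ∧ LinearMap.ker ψ ≤ Module.jacobson R P

variable {M : Type u} [Monoid M] {k : Type v} [Field k] {V : Type w} [AddCommGroup V] [Module k V]

/-- The `kM`-module `V^♯`: the socle of `Coind_{G_e}(V)`. -/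
noncomputable abbrev sharp (e : Idem M) (σ : Representation k (MaxSubgroup e) V) :=
  socle k[M] (coind e σ).asModule

end Modules

/-! ### Tensor products over a group algebra -/

section Tensor

variable {M : Type u} [Monoid M] {G : Type x} [Group G] {k : Type v} [Field k]
  {U : Type*} [AddCommGroup U] [Module k U] {V : Type*} [AddCommGroup V] [Module k V]

/-- The relations `ug ⊗ v = u ⊗ gv` defining `U ⊗_{kG} V` as a quotient of `U ⊗_k V`, for a
right `kG`-module `U` and a left `kG`-module `V`. -/
def balancedRel (τ : Representation k Gᵐᵒᵖ U) (σ : Representation k G V) :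
    Submodule k (U ⊗[k] V) :=
  Submodule.span k {z | ∃ (u : U) (g : G) (v : V),
    z = τ (MulOpposite.op g) u ⊗ₜ[k] v - u ⊗ₜ[k] σ g v}

theorem balancedRel_le (lam : Representation k M U) (τ : Representation k Gᵐᵒᵖ U)
    (σ : Representation k G V) (hc : ∀ m g, Commute (lam m) (τ g)) (m : M) :
    balancedRel τ σ ≤ (balancedRel τ σ).comap ((lam m).rTensor V) := by
  refine Submodule.span_le.mpr ?_
  rintro _ ⟨u, g, v, rfl⟩
  refine Submodule.subset_span ⟨lam m u, g, v, ?_⟩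
  have := LinearMap.congr_fun (hc m (MulOpposite.op g)).eq u
  simp only [Module.End.mul_apply] at this
  simp [this]

/-- The tensor product `U ⊗_{kG} V` of a right `kG`-module `U` and a left `kG`-module `V`. -/
def BalancedTensor (τ : Representation k Gᵐᵒᵖ U) (σ : Representation k G V) : Type _ :=
  (U ⊗[k] V) ⧸ balancedRel τ σ

instance (τ : Representation k Gᵐᵒᵖ U) (σ : Representation k G V) :
    AddCommGroup (BalancedTensor τ σ) :=
  inferInstanceAs (AddCommGroup ((U ⊗[k] V) ⧸ balancedRel τ σ))

instance (τ : Representation k Gᵐᵒᵖ U) (σ : Representation k G V) :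
    Module k (BalancedTensor τ σ) :=
  inferInstanceAs (Module k ((U ⊗[k] V) ⧸ balancedRel τ σ))

/-- The left `kM`-module `U ⊗_{kG} V`, for a `kM`-`kG`-bimodule `U` and a left `kG`-module `V`. -/
def tensorRep (lam : Representation k M U) (τ : Representation k Gᵐᵒᵖ U)
    (σ : Representation k G V) (hc : ∀ m g, Commute (lam m) (τ g)) :
    Representation k M (BalancedTensor τ σ) where
  toFun m := Submodule.mapQ (balancedRel τ σ) (balancedRel τ σ) ((lam m).rTensor V)
    (balancedRel_le lam τ σ hc m)
  map_one' := by
    refine Submodule.linearMap_qext _ (TensorProduct.ext' fun u v => ?_)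
    change Submodule.Quotient.mk (lam 1 u ⊗ₜ[k] v) = Submodule.Quotient.mk (u ⊗ₜ[k] v)
    simp
  map_mul' m n := by
    refine Submodule.linearMap_qext _ (TensorProduct.ext' fun u v => ?_)
    change Submodule.Quotient.mk (lam (m * n) u ⊗ₜ[k] v) =
      Submodule.Quotient.mk (lam m (lam n u) ⊗ₜ[k] v)
    simp

end Tensor

/-! ### The bimodule `k L̃_e` -/

section LTilde

variable {M : Type u} [Monoid M]

/-- The `L̃`-class of an idempotent `e`. -/
abbrev LTilde (e : Idem M) : Type u := {m : M // LTildeRel m e}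

variable {e : Idem M}

theorem LTilde.right_id {m : M} (hm : LTildeRel m e) : m * (e : M) = m := (hm e e.2).mpr e.2

theorem LTilde.of_mul {x m n : M} (hx : LTildeRel x e) (h : LTildeRel (m * n * x) e) :
    LTildeRel (n * x) e := by
  intro f hf
  constructor
  · intro h1
    exact (h f hf).mp (by rw [mul_assoc m, mul_assoc m, h1])
  · intro h1
    rw [mul_assoc, (hx f hf).mpr h1]

theorem LTilde.mul_mem [IsRightFountain M] {m : M} (hm : LTildeRel m e) (g : MaxSubgroup e) :
    LTildeRel (m * g.val) e := by
  obtain ⟨a, ha, h⟩ := IsRightFountain.exists_idem (m * g.val)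
  have h1 : m * g.val * a = m * g.val := (h a ha).mp ha
  have h2 : a * (e : M) = a := (h e e.2).mpr (by rw [mul_assoc, g.right_id])
  have hidem : IsIdempotentElem (g.val * a * (g⁻¹).val) := by
    calc g.val * a * (g⁻¹).val * (g.val * a * (g⁻¹).val)
        = g.val * a * ((g⁻¹).val * g.val) * a * (g⁻¹).val := by simp only [mul_assoc]
      _ = g.val * (a * e) * a * (g⁻¹).val := by rw [g.inv_mul_val]; simp only [mul_assoc]
      _ = g.val * (a * a) * (g⁻¹).val := by rw [h2]; simp only [mul_assoc]
      _ = g.val * a * (g⁻¹).val := by rw [ha]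
  have h3 : m * (g.val * a * (g⁻¹).val) = m := by
    rw [← mul_assoc, ← mul_assoc, h1, mul_assoc, g.mul_inv_val, LTilde.right_id hm]
  have h4 : g.val * a * (g⁻¹).val = e := by
    have := (hm _ hidem).mp h3
    rwa [← mul_assoc, ← mul_assoc, g.left_id] at this
  have h5 : g.val * a = g.val := by
    calc g.val * a = g.val * a * (g⁻¹).val * g.val := by
          rw [mul_assoc _ (g⁻¹).val, g.inv_mul_val, mul_assoc, h2]
      _ = g.val := by rw [h4, g.left_id]
  have h6 : (e : M) * a = e := by
    rw [← g.inv_mul_val, mul_assoc, h5]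
  intro f hf
  rw [← h f hf]
  constructor
  · intro h7
    rw [← h6, mul_assoc, h7]
  · intro h7
    rw [← h2, mul_assoc, h7]

/-- In a right Fountain monoid, `G_e` acts on the right of `L̃_e` by right multiplication. -/
instance [IsRightFountain M] : MulAction (MaxSubgroup e)ᵐᵒᵖ (LTilde e) where
  smul g x := ⟨x.1 * g.unop.val, LTilde.mul_mem x.2 _⟩
  one_smul x := Subtype.ext (LTilde.right_id x.2)
  mul_smul g h x := Subtype.ext (by
    change x.1 * (h.unop * g.unop).val = x.1 * h.unop.val * g.unop.val
    rw [MaxSubgroup.val_mul, mul_assoc])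

theorem LTilde.smul_val [IsRightFountain M] (g : (MaxSubgroup e)ᵐᵒᵖ) (x : LTilde e) :
    (g • x).1 = x.1 * g.unop.val := rfl

theorem LTilde.mul_smul_iff [IsRightFountain M] (g : (MaxSubgroup e)ᵐᵒᵖ) (x : LTilde e) (m : M) :
    LTildeRel (m * (g • x).1) e ↔ LTildeRel (m * x.1) e := by
  rw [LTilde.smul_val, ← mul_assoc]
  refine ⟨fun h => ?_, fun h => LTilde.mul_mem h _⟩
  have := LTilde.mul_mem h (g.unop)⁻¹
  rwa [mul_assoc, g.unop.mul_inv_val, mul_assoc, LTilde.right_id x.2] at this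

variable (k : Type v) [Field k] (e)

open Classical in
/-- The left `kM`-module structure on the space `k L̃_e` with basis `L̃_e`: `m ∈ M` sends a basis
element `x` to `m * x` if `m * x ∈ L̃_e`, and to `0` otherwise. -/
noncomputable def lTildeLeft : Representation k M (LTilde e →₀ k) where
  toFun m := Finsupp.linearCombination k fun x : LTilde e =>
    if h : LTildeRel (m * x.1) e then Finsupp.single (⟨m * x.1, h⟩ : LTilde e) (1 : k) else 0
  map_one' := by
    ext1 x
    ext1
    have h : LTildeRel (1 * x.1) e := by rw [one_mul]; exact x.2
    simp [x.2]
  map_mul' m n := by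
    ext1 x
    ext1
    by_cases h : LTildeRel (m * n * x.1) e
    · have h1 := LTilde.of_mul x.2 h
      have h2 : LTildeRel (m * (n * x.1)) e := by rw [← mul_assoc]; exact h
      simp [h1, h2, mul_assoc]
    · by_cases h1 : LTildeRel (n * x.1) e
      · have h2 : ¬ LTildeRel (m * (n * x.1)) e := by rw [← mul_assoc]; exact h
        simp [h1, h2, mul_assoc]
      · simp [h, h1]

/-- The right `kG_e`-module structure on `k L̃_e` given by right multiplication. -/
noncomputable def lTildeRight [IsRightFountain M] :
    Representation k (MaxSubgroup e)ᵐᵒᵖ (LTilde e →₀ k) where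
  toFun g := Finsupp.lmapDomain k k fun x : LTilde e => g • x
  map_one' := by
    ext1 x
    ext1
    simp
  map_mul' g h := by
    ext1 x
    ext1
    simp [mul_smul]

theorem lTilde_commute [IsRightFountain M] (m : M) (g : (MaxSubgroup e)ᵐᵒᵖ) :
    Commute (lTildeLeft e k m) (lTildeRight e k g) := by
  ext1 x
  ext1
  by_cases h : LTildeRel (m * x.1) e
  · have h' := (LTilde.mul_smul_iff g x m).mpr h
    have h3 : (⟨m * (g • x).1, h'⟩ : LTilde e) = g • (⟨m * x.1, h⟩ : LTilde e) :=
      Subtype.ext (mul_assoc _ _ _).symm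
    simp [lTildeLeft, lTildeRight, h, h', h3]
  · have h' := (LTilde.mul_smul_iff g x m).not.mpr h
    simp [lTildeLeft, lTildeRight, h, h']

variable {k} {V : Type w} [AddCommGroup V] [Module k V]

/-- The left `kM`-module `k L̃_e ⊗_{kG_e} V`. -/
noncomputable def lTildeTensor [IsRightFountain M] (σ : Representation k (MaxSubgroup e) V) :
    Representation k M (BalancedTensor (lTildeRight e k) σ) :=
  tensorRep (lTildeLeft e k) (lTildeRight e k) σ (lTilde_commute e k)

end LTilde

end FountainMonoid

/-!
Write `A = kM`, `X_V = k L̃_e ⊗_{kG_e} V`, and let `V` be a simple `kG_e`-module.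

There is a canonical homomorphism `headMap : X_V → Coind(V)`, `x ⊗ v ↦ (r ↦ (rx)v)`, where `rx`
acts as zero unless it lies in `G_e`. Independently of the three conditions, its image is contained
in each nonzero submodule of `Coind(V)`, hence equals the socle `V^♯` (`sharp_eq_range`), and its
kernel lies in the radical of `X_V` (`ker_headHom_le`, by looking at the apex of a simple quotient).
Consequently `Coind(V)` is simple if and only if `headMap` is surjective
(`coind_isIrreducible_iff`), and `X_V` is the projective cover of `V^♯` if and only if it is
projective (`isProjectiveCover_iff`). The conditions are then shown to imply each other cyclically.

* Coinduced modules simple ⟹ sandwich matrices right invertible. Evaluation at the elements `lam b`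
  identifies `Coind(V)` with `V^B` and the image of `headMap` with the image of the sandwich matrix
  acting on `V^A`. If this is everything for each simple `V`, then by semisimplicity of `kG_e` the
  matrix is surjective on `(kG_e)^A` (`isRightInvertible_of_surjective`).

* Sandwich matrices right invertible ⟹ `X_V` projective. Let `D` be the vector space `kM` in which
  `m` sends `x` to `mx` if `mx` is `L̃`-related to `x`, and to `0` otherwise; it is the direct sum
  of the modules `k L̃_f`. From right inverses `Q` of the sandwich matrices one forms
  `d = ∑ ρ_a Q(a, b) lam_b`, summed over all regular `J`-classes. Then `f • d` agrees with `f`, for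
  each idempotent `f`, up to combinations of elements `y ∈ fM` strictly `J`-below `f`. For `x`
  that is `L̃`-related to `f` the elements `xy` are strictly `R`-below `x` (`not_mul_mul_eq`), so
  induction shows that `d` generates `D`. As `dim D = dim A`, `D` is free of rank one. Hence
  `k L̃_e` is projective, and averaging over `G_e` exhibits `X_V` as a summand of a sum of copies of
  `k L̃_e`.

* `X_V` projective ⟹ coinduced modules simple. Decomposing `kG_e`, one lifts the basis element `e`
  along `A → k L̃_e` to an element `ε_e ∈ eA` annihilated from the left by all idempotents
  strictly `L`-below `e` (`exists_lift_of_projective`). By induction along the `J`-order the `ε_e`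
  generate `A` as a two-sided ideal (`one_mem_of_lifts`). But `ε_f` maps `Coind_{G_e}(V)` to zero
  if `f` is not `J`-equivalent to `e` (`coind_eq_zero`), and `ε_e` maps it into `e Coind(V)`, which
  is contained in the image of `headMap`. So `headMap` is surjective.
-/

namespace FountainMonoid

/-! ### Stability and regularity in finite monoids -/

section Green

variable {M : Type u} [Monoid M]

theorem lRel_iff {m n : M} : LRel m n ↔ (∃ a, m = a * n) ∧ ∃ a, n = a * m := by
  constructor
  · intro h
    exact ⟨h.subset ⟨1, (one_mul m).symm⟩, h.superset ⟨1, (one_mul n).symm⟩⟩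
  · rintro ⟨⟨a, ha⟩, ⟨b, hb⟩⟩
    ext x
    constructor
    · rintro ⟨c, rfl⟩; exact ⟨c * a, by rw [mul_assoc, ← ha]⟩
    · rintro ⟨c, rfl⟩; exact ⟨c * b, by rw [mul_assoc, ← hb]⟩

theorem jRel_iff {m n : M} :
    JRel m n ↔ (∃ a b, m = a * n * b) ∧ ∃ a b, n = a * m * b := by
  constructor
  · intro h
    exact ⟨h.subset ⟨1, 1, by simp⟩, h.superset ⟨1, 1, by simp⟩⟩
  · rintro ⟨⟨a, b, ha⟩, ⟨c, d, hb⟩⟩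
    ext x
    constructor
    · rintro ⟨p, q, rfl⟩; exact ⟨p * a, b * q, by rw [ha]; simp only [mul_assoc]⟩
    · rintro ⟨p, q, rfl⟩; exact ⟨p * c, d * q, by rw [hb]; simp only [mul_assoc]⟩

theorem LRel.jRel {m n : M} (h : LRel m n) : JRel m n := by
  obtain ⟨⟨a, ha⟩, ⟨b, hb⟩⟩ := lRel_iff.mp h
  exact jRel_iff.mpr ⟨⟨a, 1, by simpa using ha⟩, ⟨b, 1, by simpa using hb⟩⟩

theorem RRel.jRel {m n : M} (h : RRel m n) : JRel m n := by
  obtain ⟨⟨a, ha⟩, ⟨b, hb⟩⟩ := rRel_iff.mp h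
  exact jRel_iff.mpr ⟨⟨1, a, by simpa using ha⟩, ⟨1, b, by simpa using hb⟩⟩

theorem LRel.lTildeRel {m n : M} (h : LRel m n) : LTildeRel m n := by
  obtain ⟨⟨a, ha⟩, ⟨b, hb⟩⟩ := lRel_iff.mp h
  intro f _
  constructor
  · intro hf; rw [hb, mul_assoc, hf]
  · intro hf; rw [ha, mul_assoc, hf]

theorem LTildeRel.symm {m n : M} (h : LTildeRel m n) : LTildeRel n m :=
  fun f hf => (h f hf).symm

theorem LTildeRel.trans {m n p : M} (h : LTildeRel m n) (h' : LTildeRel n p) : LTildeRel m p :=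
  fun f hf => (h f hf).trans (h' f hf)

theorem LTildeRel.mul_right_eq {m f : M} (h : LTildeRel m f) (hf : IsIdempotentElem f) :
    m * f = m := (h f hf).mpr hf

/-- If multiplication by `mn` preserves the `L̃`-class of `x`, then so does multiplication by `n`. -/
theorem LTildeRel.of_mul_mul {x m n : M} (h : LTildeRel (m * n * x) x) :
    LTildeRel (n * x) x := by
  intro f hf
  constructor
  · intro h1
    exact (h f hf).mp (by rw [mul_assoc m, mul_assoc m, h1])
  · intro h1
    rw [mul_assoc, h1]

/-- A regular element that is `L̃`-related to an idempotent is `L`-related to it. -/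
theorem LTildeRel.lRel_of_regular {x y f : M} (hf : IsIdempotentElem f) (h : LTildeRel x f)
    (hx : x * y * x = x) : LRel x f := by
  have hi : IsIdempotentElem (y * x) := by
    unfold IsIdempotentElem
    rw [mul_assoc y, ← mul_assoc x, hx]
  refine lRel_iff.mpr ⟨⟨x, (h.mul_right_eq hf).symm⟩, ⟨f * y, ?_⟩⟩
  have := (h _ hi).mp (by rw [← mul_assoc, hx])
  rw [mul_assoc, this]

theorem RRel.exists_regular {x f : M} (hf : IsIdempotentElem f) (h : RRel x f) :
    ∃ y, x * y = f ∧ f * x = x ∧ x * y * x = x := by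
  obtain ⟨⟨a, ha⟩, ⟨b, hb⟩⟩ := rRel_iff.mp h
  have h1 : f * x = x := by rw [ha, ← mul_assoc, hf]
  exact ⟨b, hb.symm, h1, by rw [← hb, h1]⟩

section Finite

variable [Finite M]

/-- In a finite monoid every element has an idempotent positive power. -/
theorem exists_isIdempotentElem_pow (x : M) : ∃ n, 0 < n ∧ IsIdempotentElem (x ^ n) := by
  obtain ⟨i, j, hij, h⟩ := Finite.exists_ne_map_eq_of_infinite fun n : ℕ => x ^ n
  wlog hlt : i < j generalizing i j
  · exact this j i hij.symm h.symm (lt_of_le_of_ne (not_lt.mp hlt) hij.symm)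
  obtain ⟨p, rfl⟩ := Nat.exists_eq_add_of_lt hlt
  have hper : ∀ t m, i ≤ m → x ^ (m + t * (p + 1)) = x ^ m := by
    intro t
    induction t with
    | zero => intro m _; simp
    | succ t ih =>
      intro m hm
      obtain ⟨q, rfl⟩ := Nat.exists_eq_add_of_le hm
      rw [show i + q + (t + 1) * (p + 1) = (i + p + 1 + q) + t * (p + 1) by ring,
        ih _ (by omega), pow_add _ (i + p + 1), ← h, ← pow_add]
  refine ⟨(i + 1) * (p + 1), by positivity, ?_⟩
  unfold IsIdempotentElem
  rw [← pow_add]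
  exact hper (i + 1) _ (by nlinarith)

/-- Stability of finite monoids, left version. -/
theorem left_stable {a b : M} (hab : ∃ u, a = u * b) (hba : ∃ x y, b = x * a * y) :
    ∃ z, b = z * a := by
  obtain ⟨u, rfl⟩ := hab
  obtain ⟨x, y, h⟩ := hba
  obtain ⟨n, hn, hE⟩ := exists_isIdempotentElem_pow (x * u)
  have hpow : ∀ n, b = (x * u) ^ n * b * y ^ n := by
    intro n
    induction n with
    | zero => simp
    | succ n ih =>
      calc b = (x * u) ^ n * b * y ^ n := ih
        _ = (x * u) ^ n * (x * (u * b) * y) * y ^ n := by rw [← h]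
        _ = _ := by rw [pow_succ, pow_succ' y]; simp only [mul_assoc]
  have hfix : (x * u) ^ n * b = b := by
    conv_lhs => rw [hpow n]
    rw [← mul_assoc, ← mul_assoc, hE, ← hpow n]
  obtain ⟨m, rfl⟩ := Nat.exists_eq_succ_of_ne_zero hn.ne'
  refine ⟨(x * u) ^ m * x, ?_⟩
  rw [Nat.succ_eq_add_one, pow_succ] at hfix
  rw [← hfix]
  conv_rhs => rw [hfix]
  simp only [mul_assoc]

/-- Stability of finite monoids, right version. -/
theorem right_stable {a b : M} (hab : ∃ u, a = b * u) (hba : ∃ x y, b = x * a * y) :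
    ∃ z, b = a * z := by
  obtain ⟨u, hu⟩ := hab
  obtain ⟨x, y, h⟩ := hba
  have : Finite Mᵐᵒᵖ := Finite.of_equiv M MulOpposite.opEquiv
  obtain ⟨z, hz⟩ := left_stable (a := MulOpposite.op a) (b := MulOpposite.op b)
    ⟨MulOpposite.op u, by rw [← MulOpposite.op_mul, hu]⟩
    ⟨MulOpposite.op y, MulOpposite.op x, by
      rw [← MulOpposite.op_mul, ← MulOpposite.op_mul, ← mul_assoc, ← h]⟩
  exact ⟨z.unop, MulOpposite.op_injective (by simpa using hz)⟩

theorem rRel_of_mul_left {f x : M} (hx : f * x = x) (h : ∃ a b, f = a * x * b) : RRel x f :=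
  rRel_iff.mpr ⟨⟨x, hx.symm⟩, right_stable ⟨x, hx.symm⟩ h⟩

theorem lRel_of_mul_right {f x : M} (hx : x * f = x) (h : ∃ a b, f = a * x * b) : LRel x f :=
  lRel_iff.mpr ⟨⟨x, hx.symm⟩, left_stable ⟨x, hx.symm⟩ h⟩

/-- The elements of `G_e` are the elements of `R_e` with right identity `e`. -/
theorem exists_maxSubgroup_of_rRel {e : Idem M} {x : M} (h : RRel x e) (hx : x * (e : M) = x) :
    ∃ g : MaxSubgroup e, g.val = x := by
  obtain ⟨y, hxy, hex, -⟩ := h.exists_regular e.2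
  obtain ⟨-, ⟨z, hz⟩⟩ := lRel_iff.mp (lRel_of_mul_right hx ⟨1, y, by rw [one_mul, hxy]⟩)
  have he := e.2.eq
  have hy' : x * (e * y * e) = e := by rw [← mul_assoc, ← mul_assoc, hx, hxy, he]
  have hz' : e * y * e * x = e := by
    have h1 : (e : M) * z * x = e := by rw [mul_assoc, ← hz, he]
    calc (e : M) * y * e * x = e * y * x := by rw [mul_assoc _ _ x, hex]
      _ = (e * z * x) * (y * x) := by rw [h1]; simp only [mul_assoc]
      _ = e * z * (x * y) * x := by simp only [mul_assoc]
      _ = e := by rw [hxy, mul_assoc _ _ x, hex, h1]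
  refine ⟨⟨⟨x, hex, hx⟩, ⟨e * y * e, ?_, ?_⟩, LocalMonoid.ext hy', LocalMonoid.ext hz'⟩, rfl⟩
  · rw [← mul_assoc, ← mul_assoc, he]
  · rw [mul_assoc, he]

end Finite

namespace MaxSubgroup

variable {e : Idem M}

theorem val_injective : Function.Injective (MaxSubgroup.val : MaxSubgroup e → M) :=
  fun _ _ h => Units.ext (LocalMonoid.ext h)

theorem rRel (g : MaxSubgroup e) : RRel g.val e :=
  rRel_iff.mpr ⟨⟨g.val, g.left_id.symm⟩, ⟨_, g.mul_inv_val.symm⟩⟩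

theorem lRel (g : MaxSubgroup e) : LRel g.val e :=
  lRel_iff.mpr ⟨⟨g.val, g.right_id.symm⟩, ⟨_, g.inv_mul_val.symm⟩⟩

end MaxSubgroup

/-- An element `x ∈ Me` with a left multiple in `G_e` lies in `L_e`. -/
theorem lRel_of_mul_eq_val {e : Idem M} {r x : M} {g : MaxSubgroup e} (hx : x * (e : M) = x)
    (h : g.val = r * x) : LRel x e :=
  lRel_iff.mpr ⟨⟨x, hx.symm⟩, ⟨g⁻¹.val * r, by rw [mul_assoc, ← h, g.inv_mul_val]⟩⟩

theorem rRel_of_mul_eq_val {e : Idem M} {r x : M} {g : MaxSubgroup e} (hr : (e : M) * r = r)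
    (h : g.val = r * x) : RRel r e :=
  rRel_iff.mpr ⟨⟨r, hr.symm⟩, ⟨x * g⁻¹.val, by rw [← mul_assoc, ← h, g.mul_inv_val]⟩⟩

/-- Two elements of `L_e` in the same `R`-class differ by an element of `G_e`. -/
theorem exists_mul_val_of_lRel_of_rRel {e : Idem M} {x y : M} (hx : LRel x e) (hy : LRel y e)
    (h : RRel x y) : ∃ g : MaxSubgroup e, x = y * g.val := by
  obtain ⟨⟨a, ha⟩, ⟨b, hb⟩⟩ := rRel_iff.mp h
  obtain ⟨⟨c, hc⟩, ⟨s, hs⟩⟩ := lRel_iff.mp hx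
  obtain ⟨⟨d, hd⟩, ⟨t, ht⟩⟩ := lRel_iff.mp hy
  have he := e.2.eq
  have hxe : x * (e : M) = x := by rw [hc, mul_assoc, he]
  have hye : y * (e : M) = y := by rw [hd, mul_assoc, he]
  have h1 : y * (e * a * e) = x := by rw [← mul_assoc, ← mul_assoc, hye, ← ha, hxe]
  have h2 : x * (e * b * e) = y := by rw [← mul_assoc, ← mul_assoc, hxe, ← hb, hye]
  have h3 : (e : M) * a * e * (e * b * e) = e := by
    have h4 : y * (e * a * e * (e * b * e)) = y := by rw [← mul_assoc, h1, h2]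
    calc (e : M) * a * e * (e * b * e) = e * (e * a * e * (e * b * e)) := by
          simp only [← mul_assoc, he]
      _ = t * (y * (e * a * e * (e * b * e))) := by rw [← mul_assoc t, ← ht]
      _ = e := by rw [h4, ← ht]
  have h3' : (e : M) * b * e * (e * a * e) = e := by
    have h4 : x * (e * b * e * (e * a * e)) = x := by rw [← mul_assoc, h2, h1]
    calc (e : M) * b * e * (e * a * e) = e * (e * b * e * (e * a * e)) := by
          simp only [← mul_assoc, he]
      _ = s * (x * (e * b * e * (e * a * e))) := by rw [← mul_assoc s, ← hs]
      _ = e := by rw [h4, ← hs]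
  refine ⟨⟨⟨e * a * e, ?_, ?_⟩, ⟨e * b * e, ?_, ?_⟩, LocalMonoid.ext h3, LocalMonoid.ext h3'⟩,
    h1.symm⟩
  · rw [← mul_assoc, ← mul_assoc, he]
  · rw [mul_assoc, he]
  · rw [← mul_assoc, ← mul_assoc, he]
  · rw [mul_assoc, he]

end Green

/-! ### The canonical homomorphism onto the socle of a coinduced module -/

section Head

variable {M : Type u} [Monoid M] {k : Type v} [Field k] {V : Type w} [AddCommGroup V] [Module k V]
  {e : Idem M} (σ : Representation k (MaxSubgroup e) V)

open Classical in
/-- A representation of `G_e` extended by zero to all of `M`. It is multiplicative only in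
restricted situations, see `zeroExt_val_mul` and `zeroExt_mul_val`. -/
noncomputable def zeroExt (m : M) : V →ₗ[k] V :=
  if h : ∃ g : MaxSubgroup e, g.val = m then σ h.choose else 0

@[simp] theorem zeroExt_val (g : MaxSubgroup e) : zeroExt σ g.val = σ g := by
  have h : ∃ g' : MaxSubgroup e, g'.val = g.val := ⟨g, rfl⟩
  rw [zeroExt, dif_pos h, MaxSubgroup.val_injective h.choose_spec]

theorem zeroExt_of_not {m : M} (h : ¬ ∃ g : MaxSubgroup e, g.val = m) : zeroExt σ m = 0 :=
  dif_neg h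

theorem zeroExt_val_mul (g : MaxSubgroup e) {m : M} (hm : (e : M) * m = m) :
    zeroExt σ (g.val * m) = σ g ∘ₗ zeroExt σ m := by
  by_cases h : ∃ g' : MaxSubgroup e, g'.val = m
  · obtain ⟨g', rfl⟩ := h
    rw [← MaxSubgroup.val_mul, zeroExt_val, zeroExt_val, map_mul]; rfl
  · rw [zeroExt_of_not σ h, zeroExt_of_not, LinearMap.comp_zero]
    rintro ⟨g', hg'⟩
    exact h ⟨g⁻¹ * g', by
      rw [MaxSubgroup.val_mul, hg', ← mul_assoc, g.inv_mul_val, hm]⟩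

theorem zeroExt_mul_val (g : MaxSubgroup e) {m : M} (hm : m * (e : M) = m) :
    zeroExt σ (m * g.val) = zeroExt σ m ∘ₗ σ g := by
  by_cases h : ∃ g' : MaxSubgroup e, g'.val = m
  · obtain ⟨g', rfl⟩ := h
    rw [← MaxSubgroup.val_mul, zeroExt_val, zeroExt_val, map_mul]; rfl
  · rw [zeroExt_of_not σ h, zeroExt_of_not, LinearMap.zero_comp]
    rintro ⟨g', hg'⟩
    exact h ⟨g' * g⁻¹, by
      rw [MaxSubgroup.val_mul, hg', mul_assoc, g.mul_inv_val, hm]⟩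

/-- The element `e` of `R_e`. -/
def RClass.base (e : Idem M) : RClass e := ⟨e, rfl⟩

/-- The element `e` of `L̃_e`. -/
def LTilde.base (e : Idem M) : LTilde e := ⟨e, fun _ _ => Iff.rfl⟩

/-- Evaluation of elements of `Coind_{G_e}(V)` at an element of `R_e`. -/
def CoindSpace.eval (r : RClass e) : CoindSpace e σ →ₗ[k] V :=
  (LinearMap.proj r : (RClass e → V) →ₗ[k] V) ∘ₗ (coindV e σ).subtype

theorem CoindSpace.ext {f f' : CoindSpace e σ}
    (h : ∀ r, CoindSpace.eval σ r f = CoindSpace.eval σ r f') : f = f' :=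
  Subtype.ext (funext h)

theorem CoindSpace.eval_smul (g : MaxSubgroup e) (r : RClass e) (f : CoindSpace e σ) :
    CoindSpace.eval σ (g • r) f = σ g (CoindSpace.eval σ r f) := f.2 g r

theorem coind_eval_of_rRel {m : M} {r : RClass e} (h : RRel (r.1 * m) e) (f : CoindSpace e σ) :
    CoindSpace.eval σ r (coind e σ m f) = CoindSpace.eval σ ⟨r.1 * m, h⟩ f :=
  dif_pos h

theorem coind_eval_of_not {m : M} {r : RClass e} (h : ¬ RRel (r.1 * m) e) (f : CoindSpace e σ) :
    CoindSpace.eval σ r (coind e σ m f) = 0 :=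
  dif_neg h

/-- The map `V → Coind_{G_e}(V)` sending `v` to the function `r ↦ (rm)v`, where `rm` acts as zero
unless it lies in `G_e`. -/
noncomputable def coindOf (m : M) : V →ₗ[k] CoindSpace e σ where
  toFun v := (⟨fun r => zeroExt σ (r.1 * m) v, fun g r => by
    have : (e : M) * (r.1 * m) = r.1 * m := by rw [← mul_assoc, r.left_id]
    change zeroExt σ (g.val * r.1 * m) v = σ g (zeroExt σ (r.1 * m) v)
    rw [mul_assoc, zeroExt_val_mul σ g this]; rfl⟩ : coindV e σ)
  map_add' v w := CoindSpace.ext σ fun r => map_add (zeroExt σ (r.1 * m)) v w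
  map_smul' c v := CoindSpace.ext σ fun r => map_smul (zeroExt σ (r.1 * m)) c v

@[simp] theorem eval_coindOf (r : RClass e) (m : M) (v : V) :
    CoindSpace.eval σ r (coindOf σ m v) = zeroExt σ (r.1 * m) v := rfl

theorem coind_coindOf (m x : M) (v : V) : coind e σ m (coindOf σ x v) = coindOf σ (m * x) v := by
  refine CoindSpace.ext σ fun r => ?_
  by_cases h : RRel (r.1 * m) e
  · rw [coind_eval_of_rRel σ h, eval_coindOf, eval_coindOf, mul_assoc]
  · rw [coind_eval_of_not σ h, eval_coindOf, zeroExt_of_not, LinearMap.zero_apply]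
    rintro ⟨g, hg⟩
    exact h (rRel_of_mul_eq_val (by rw [← mul_assoc, r.left_id]) (by rw [hg, mul_assoc]))

theorem eval_base_coindOf (v : V) :
    CoindSpace.eval σ (RClass.base e) (coindOf σ (e : M) v) = v := by
  have h : (RClass.base e).1 * (e : M) = (1 : MaxSubgroup e).val := e.2
  rw [eval_coindOf, h, zeroExt_val, map_one]; rfl

theorem coindOf_eq_zero {x : M} (hx : x * (e : M) = x) (h : ¬ LTildeRel x e) :
    coindOf σ x = 0 := by
  refine LinearMap.ext fun v => CoindSpace.ext σ fun r => ?_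
  rw [eval_coindOf, zeroExt_of_not]; · rfl
  rintro ⟨g, hg⟩
  exact h (lRel_of_mul_eq_val hx hg).lTildeRel

theorem coindOf_mul_val (g : MaxSubgroup e) {x : M} (hx : x * (e : M) = x) (v : V) :
    coindOf σ (x * g.val) v = coindOf σ x (σ g v) := by
  refine CoindSpace.ext σ fun r => ?_
  rw [eval_coindOf, eval_coindOf, ← mul_assoc, zeroExt_mul_val σ g (by rw [mul_assoc, hx])]
  rfl

/-- The idempotent `e` maps `Coind_{G_e}(V)` onto a copy of `V`. -/
theorem coind_idem [Finite M] (f : CoindSpace e σ) :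
    coind e σ (e : M) f = coindOf σ (e : M) (CoindSpace.eval σ (RClass.base e) f) := by
  refine CoindSpace.ext σ fun r => ?_
  by_cases h : RRel (r.1 * (e : M)) e
  · obtain ⟨g, hg⟩ := exists_maxSubgroup_of_rRel h (by rw [mul_assoc, e.2])
    have h1 : (⟨r.1 * (e : M), h⟩ : RClass e) = g • RClass.base e :=
      Subtype.ext (hg.symm.trans g.right_id.symm)
    rw [coind_eval_of_rRel σ h, h1, eval_coindOf, ← hg, zeroExt_val, CoindSpace.eval_smul]
  · rw [coind_eval_of_not σ h, eval_coindOf, zeroExt_of_not, LinearMap.zero_apply]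
    rintro ⟨g, hg⟩
    exact h (hg ▸ g.rRel)

/-- The projection `U ⊗_k V → U ⊗_{kG} V`. -/
def balancedMk {G : Type*} [Group G] {U : Type*} [AddCommGroup U] [Module k U]
    (τ : Representation k Gᵐᵒᵖ U) (σ : Representation k G V) :
    U ⊗[k] V →ₗ[k] BalancedTensor τ σ :=
  (balancedRel τ σ).mkQ

/-- The linear map out of `U ⊗_{kG} V` induced by a balanced map. -/
def balancedLift {G : Type*} [Group G] {U : Type*} [AddCommGroup U] [Module k U]
    (τ : Representation k Gᵐᵒᵖ U) (σ : Representation k G V) {W : Type*} [AddCommGroup W]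
    [Module k W] (f : U ⊗[k] V →ₗ[k] W)
    (h : ∀ u g v, f (τ (MulOpposite.op g) u ⊗ₜ v) = f (u ⊗ₜ σ g v)) :
    BalancedTensor τ σ →ₗ[k] W :=
  (balancedRel τ σ).liftQ f (by
    refine Submodule.span_le.mpr ?_
    rintro _ ⟨a, g, v, rfl⟩
    rw [SetLike.mem_coe, LinearMap.mem_ker, map_sub, sub_eq_zero, h])

theorem lTildeLeft_single {m : M} {x : LTilde e} (h : LTildeRel (m * x.1) e) (c : k) :
    lTildeLeft e k m (Finsupp.single x c) = Finsupp.single ⟨m * x.1, h⟩ c := by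
  simp [lTildeLeft, h]

theorem lTildeLeft_single_of_not {m : M} {x : LTilde e} (h : ¬ LTildeRel (m * x.1) e) (c : k) :
    lTildeLeft e k m (Finsupp.single x c) = 0 := by
  simp only [lTildeLeft, MonoidHom.coe_mk, OneHom.coe_mk, Finsupp.linearCombination_single,
    dif_neg h, smul_zero]

theorem lTildeRight_single [IsRightFountain M] (g : (MaxSubgroup e)ᵐᵒᵖ) (x : LTilde e) (c : k) :
    lTildeRight e k g (Finsupp.single x c) = Finsupp.single (g • x) c :=
  Finsupp.mapDomain_single

variable [IsRightFountain M]

/-- The elementary tensor `x ⊗ v` of `k L̃_e ⊗_{kG_e} V`. -/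
noncomputable def lTmul (x : LTilde e) : V →ₗ[k] BalancedTensor (lTildeRight e k) σ :=
  balancedMk (lTildeRight e k) σ ∘ₗ
    TensorProduct.mk k (LTilde e →₀ k) V (Finsupp.single x (1 : k))

theorem lTmul_smul (g : MaxSubgroup e) (x : LTilde e) (v : V) :
    lTmul σ (MulOpposite.op g • x) v = lTmul σ x (σ g v) := by
  refine (Submodule.Quotient.eq _).mpr
    (Submodule.subset_span ⟨Finsupp.single x (1 : k), g, v, ?_⟩)
  rw [lTildeRight_single]
  rfl

/-- The elementary tensors generate `k L̃_e ⊗_{kG_e} V` as an additive group. -/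
theorem lTmul_induction {p : BalancedTensor (lTildeRight e k) σ → Prop}
    (zero : p 0) (add : ∀ s t, p s → p t → p (s + t)) (lTmul : ∀ x v, p (lTmul σ x v))
    (t : BalancedTensor (lTildeRight e k) σ) : p t := by
  obtain ⟨t, rfl⟩ : ∃ t', balancedMk (lTildeRight e k) σ t' = t := Submodule.mkQ_surjective _ t
  induction t using TensorProduct.induction_on with
  | zero => rw [map_zero]; exact zero
  | add s t hs ht => rw [map_add]; exact add _ _ hs ht
  | tmul a v =>
    induction a using Finsupp.induction_linear with
    | zero => rw [TensorProduct.zero_tmul, map_zero]; exact zero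
    | add a b ha hb => rw [TensorProduct.add_tmul, map_add]; exact add _ _ ha hb
    | single x c =>
      have : Finsupp.single x c = c • Finsupp.single x (1 : k) := by simp
      rw [this, TensorProduct.smul_tmul]
      exact lTmul x (c • v)

theorem lTildeTensor_hom_ext {W : Type*} [AddCommGroup W] [Module k W]
    {φ ψ : BalancedTensor (lTildeRight e k) σ →ₗ[k] W}
    (h : ∀ x v, φ (lTmul σ x v) = ψ (lTmul σ x v)) : φ = ψ :=
  LinearMap.ext fun t => lTmul_induction σ (p := fun t => φ t = ψ t) (by simp)
    (fun s t hs ht => by rw [map_add, map_add, hs, ht]) h t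

theorem lTildeTensor_lTmul {m : M} {x : LTilde e} (h : LTildeRel (m * x.1) e) (v : V) :
    lTildeTensor e σ m (lTmul σ x v) = lTmul σ ⟨m * x.1, h⟩ v := by
  change balancedMk _ σ (lTildeLeft e k m (Finsupp.single x 1) ⊗ₜ[k] v) = _
  rw [lTildeLeft_single h]
  rfl

theorem lTildeTensor_lTmul_of_not {m : M} {x : LTilde e} (h : ¬ LTildeRel (m * x.1) e) (v : V) :
    lTildeTensor e σ m (lTmul σ x v) = 0 := by
  change balancedMk _ σ (lTildeLeft e k m (Finsupp.single x 1) ⊗ₜ[k] v) = _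
  rw [lTildeLeft_single_of_not h, TensorProduct.zero_tmul, map_zero]

theorem lTmul_eq_base (x : LTilde e) (v : V) :
    lTmul σ x v = lTildeTensor e σ x.1 (lTmul σ (LTilde.base e) v) := by
  have h : x.1 * (LTilde.base e).1 = x.1 := LTilde.right_id x.2
  have h' : LTildeRel (x.1 * (LTilde.base e).1) e := by rw [h]; exact x.2
  have h2 : (⟨_, h'⟩ : LTilde e) = x := Subtype.ext h
  rw [lTildeTensor_lTmul σ h', h2]

/-- The linear map underlying `headMap`. -/
noncomputable def headLin : BalancedTensor (lTildeRight e k) σ →ₗ[k] CoindSpace e σ :=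
  balancedLift _ σ
    (TensorProduct.lift (Finsupp.linearCombination k fun x : LTilde e => coindOf σ x.1)) (by
      intro a g v
      rw [TensorProduct.lift.tmul, TensorProduct.lift.tmul]
      induction a using Finsupp.induction_linear with
      | zero => simp
      | add a b ha hb => simp only [map_add, LinearMap.add_apply, ha, hb]
      | single x c =>
        have := coindOf_mul_val σ g (LTilde.right_id x.2) v
        rw [lTildeRight_single, Finsupp.linearCombination_single,
          Finsupp.linearCombination_single, LinearMap.smul_apply, LinearMap.smul_apply, ← this]
        rfl)

theorem headLin_lTmul (x : LTilde e) (v : V) :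
    headLin σ (lTmul σ x v) = coindOf σ x.1 v := by
  change TensorProduct.lift _ (Finsupp.single x (1 : k) ⊗ₜ[k] v) = _
  simp

/-- The homomorphism `k L̃_e ⊗_{kG_e} V → Coind_{G_e}(V)` sending `x ⊗ v` to the function
`r ↦ (rx)v`, where `rx` acts as zero unless it lies in `G_e`. -/
noncomputable def headMap : (lTildeTensor e σ).IntertwiningMap (coind e σ) where
  toLinearMap := headLin σ
  isIntertwining' m := by
    refine lTildeTensor_hom_ext σ fun x v => ?_
    rw [LinearMap.comp_apply, LinearMap.comp_apply, headLin_lTmul, coind_coindOf]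
    by_cases h : LTildeRel (m * x.1) e
    · rw [lTildeTensor_lTmul σ h, headLin_lTmul]
    · rw [lTildeTensor_lTmul_of_not σ h, map_zero, coindOf_eq_zero σ _ h, LinearMap.zero_apply]
      rw [mul_assoc, LTilde.right_id x.2]

@[simp] theorem headMap_lTmul (x : LTilde e) (v : V) :
    headMap σ (lTmul σ x v) = coindOf σ x.1 v :=
  headLin_lTmul σ x v

theorem range_headMap_ne_bot [σ.IsIrreducible] : (headMap σ).range ≠ ⊥ := by
  intro hbot
  obtain ⟨v, hv⟩ : ∃ v : V, v ≠ 0 := by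
    by_contra! h
    have : (⊥ : Subrepresentation σ) = ⊤ := by
      refine le_antisymm bot_le fun v _ => ?_
      rw [h v]; exact Submodule.zero_mem _
    exact bot_ne_top this
  refine hv ?_
  have hmem : coindOf σ (e : M) v ∈ (headMap σ).range :=
    ⟨lTmul σ (LTilde.base e) v, headMap_lTmul σ _ _⟩
  rw [hbot] at hmem
  have : coindOf σ (e : M) v = 0 := (Submodule.mem_bot k).mp hmem
  rw [← eval_base_coindOf σ v, this, map_zero]

variable [Finite M]

/-- Every function in `e Coind_{G_e}(V)` is in the image of `headMap`. -/
theorem coind_idem_mem_range (f : CoindSpace e σ) :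
    coind e σ (e : M) f ∈ (headMap σ).range :=
  ⟨lTmul σ (LTilde.base e) (CoindSpace.eval σ (RClass.base e) f), by
    rw [coind_idem]; exact headMap_lTmul σ _ _⟩

/-- If `V` is simple, then the image of `headMap` lies in each nonzero submodule of
`Coind_{G_e}(V)`. -/
theorem range_headMap_le [σ.IsIrreducible] (W : Subrepresentation (coind e σ)) (hW : W ≠ ⊥) :
    (headMap σ).range ≤ W := by
  obtain ⟨f, hf, hf0⟩ : ∃ f ∈ W, f ≠ 0 := by
    by_contra! h
    exact hW (le_bot_iff.mp fun f hf => (Submodule.mem_bot k).mpr (h f hf))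
  obtain ⟨r, hr⟩ : ∃ r, CoindSpace.eval σ r f ≠ 0 := by
    by_contra! h
    exact hf0 (CoindSpace.ext σ fun r => by rw [h r, map_zero])
  let U : Subrepresentation σ :=
    { toSubmodule := W.toSubmodule.comap (coindOf σ (e : M))
      apply_mem_toSubmodule := fun g v hv => by
        change coindOf σ (e : M) (σ g v) ∈ W.toSubmodule
        rw [← coindOf_mul_val σ g e.2.eq, g.left_id, ← g.right_id, ← coind_coindOf]
        exact W.apply_mem_toSubmodule _ hv }
  have hU : U = ⊤ := by
    refine (eq_bot_or_eq_top U).resolve_left fun hbot => hr ?_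
    have hmem : CoindSpace.eval σ r f ∈ U := by
      change coindOf σ (e : M) (CoindSpace.eval σ r f) ∈ W.toSubmodule
      have h1 : RRel ((RClass.base e).1 * r.1) e := by
        rw [show (RClass.base e).1 * r.1 = r.1 from r.left_id]; exact r.2
      have h2 : (⟨_, h1⟩ : RClass e) = r := Subtype.ext r.left_id
      have h3 := coind_idem σ (coind e σ r.1 f)
      rw [coind_eval_of_rRel σ h1, h2] at h3
      rw [← h3]
      exact W.apply_mem_toSubmodule _ (W.apply_mem_toSubmodule _ hf)
    rw [hbot] at hmem
    exact (Submodule.mem_bot k).mp hmem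
  have hle : (⊤ : Submodule k (BalancedTensor (lTildeRight e k) σ)) ≤
      W.toSubmodule.comap (headMap σ).toLinearMap := by
    have : (W.toSubmodule.mkQ ∘ₗ (headMap σ).toLinearMap) = 0 := by
      refine lTildeTensor_hom_ext σ fun x v => ?_
      rw [LinearMap.comp_apply, LinearMap.zero_apply, Submodule.mkQ_apply,
        Submodule.Quotient.mk_eq_zero, lTmul_eq_base]
      change headMap σ _ ∈ _
      rw [Representation.IntertwiningMap.isIntertwining, headMap_lTmul]
      have hv : v ∈ U := by rw [hU]; exact Submodule.mem_top
      exact W.apply_mem_toSubmodule _ hv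
    intro t _
    have := LinearMap.congr_fun this t
    rwa [LinearMap.comp_apply, LinearMap.zero_apply, Submodule.mkQ_apply,
        Submodule.Quotient.mk_eq_zero] at this
  rintro _ ⟨t, rfl⟩
  exact hle (Submodule.mem_top (x := t))

theorem coind_isIrreducible_iff [σ.IsIrreducible] :
    (coind e σ).IsIrreducible ↔ Function.Surjective (headMap σ) := by
  constructor
  · intro h f
    have htop := (eq_bot_or_eq_top (headMap σ).range).resolve_left (range_headMap_ne_bot σ)
    have : f ∈ (headMap σ).range := by rw [htop]; exact Submodule.mem_top
    exact this
  · intro h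
    have htop : (⊤ : Subrepresentation (coind e σ)) ≤ (headMap σ).range := fun f _ => h f
    have : Nontrivial (Subrepresentation (coind e σ)) :=
      ⟨⊥, ⊤, fun hbt => range_headMap_ne_bot σ (le_bot_iff.mp (hbt ▸ le_top))⟩
    exact ⟨fun W => or_iff_not_imp_left.mpr fun hW =>
      top_le_iff.mp (htop.trans (range_headMap_le σ W hW))⟩

/-- `headMap` as a homomorphism of `kM`-modules. -/
noncomputable def headHom : (lTildeTensor e σ).asModule →ₗ[k[M]] (coind e σ).asModule :=
  Representation.IntertwiningMap.equivLinearMapAsModule _ _ (headMap σ)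

/-- For simple `V`, the socle of `Coind_{G_e}(V)` is the image of the canonical homomorphism. -/
theorem sharp_eq_range [σ.IsIrreducible] : sharp e σ = LinearMap.range (headHom σ) := by
  have hle : ∀ N : Submodule k[M] (coind e σ).asModule, N ≠ ⊥ →
      LinearMap.range (headHom σ) ≤ N := by
    intro N hN
    have := range_headMap_le σ (Subrepresentation.ofSubmodule' N) fun hbot => hN ?_
    · rintro _ ⟨t, rfl⟩
      exact this ⟨t, rfl⟩
    · refine le_bot_iff.mp fun x hx => (Submodule.mem_bot _).mpr ?_
      have : x ∈ Subrepresentation.ofSubmodule' N := hx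
      rw [hbot] at this
      exact (Submodule.mem_bot k).mp this
  have hne : LinearMap.range (headHom σ) ≠ ⊥ := by
    intro hbot
    refine range_headMap_ne_bot σ (le_bot_iff.mp ?_)
    rintro _ ⟨t, rfl⟩
    have h : headHom σ t ∈ LinearMap.range (headHom σ) := ⟨t, rfl⟩
    rw [hbot] at h
    have h0 : headHom σ t = 0 := (Submodule.mem_bot k[M]).mp h
    exact (Submodule.mem_bot k).mpr h0
  refine le_antisymm (sSup_le fun N hN => ?_) (le_sSup ?_)
  · have hN' : IsSimpleModule k[M] N := hN
    have hNat : IsAtom N := isSimpleModule_iff_isAtom.mp hN'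
    have h1 := hle N hNat.1
    rcases hNat.le_iff.mp h1 with h | h
    · exact absurd h hne
    · exact h.ge
  · refine isSimpleModule_iff_isAtom.mpr ⟨hne, fun N hN => ?_⟩
    by_contra hN0
    exact absurd (hle N hN0) (not_le_of_gt hN)

end Head

/-! ### The kernel of the canonical homomorphism lies in the radical -/

section Apex

variable {M : Type u} [Monoid M] {k : Type v} [Field k]
  {S : Type w} [AddCommGroup S] [Module k[M] S]

/-- `m` does not annihilate the `kM`-module `S`. -/
def ActsNonzero (k : Type v) [Field k] (S : Type w) [AddCommGroup S] [Module k[M] S] (m : M) :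
    Prop :=
  ∃ s : S, MonoidAlgebra.single m (1 : k) • s ≠ 0

theorem single_smul_single_smul (m n : M) (s : S) :
    MonoidAlgebra.single m (1 : k) • MonoidAlgebra.single n (1 : k) • s =
      MonoidAlgebra.single (m * n) (1 : k) • s := by
  rw [smul_smul, MonoidAlgebra.single_mul_single, one_mul]

theorem ActsNonzero.of_mul {m x n : M} (h : ActsNonzero k S (m * x * n)) : ActsNonzero k S x := by
  obtain ⟨s, hs⟩ := h
  refine ⟨MonoidAlgebra.single n (1 : k) • s, fun h0 => hs ?_⟩
  rw [mul_assoc, ← single_smul_single_smul, ← single_smul_single_smul, h0, smul_zero]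

/-- In a simple module, any element acting nonzero can be made to act nonzero on a given nonzero
vector after moving that vector by an element of the monoid. -/
theorem ActsNonzero.exists_mul [IsSimpleModule k[M] S] {m : M} (h : ActsNonzero k S m) {s : S}
    (hs : s ≠ 0) : ∃ n : M, MonoidAlgebra.single (m * n) (1 : k) • s ≠ 0 := by
  by_contra! h0
  obtain ⟨t, ht⟩ := h
  have : t ∈ Submodule.span k[M] {s} := by
    rw [IsSimpleModule.span_singleton_eq_top k[M] hs]; trivial
  obtain ⟨a, rfl⟩ := Submodule.mem_span_singleton.mp this
  refine ht ?_
  induction a using MonoidAlgebra.induction_linear with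
  | zero => simp
  | add a b ha hb =>
    rw [add_smul, smul_add]
    by_cases ha0 : MonoidAlgebra.single m (1 : k) • a • s = 0
    · by_cases hb0 : MonoidAlgebra.single m (1 : k) • b • s = 0
      · rw [ha0, hb0, add_zero]
      · exact absurd (hb hb0 (Submodule.smul_mem _ _ (Submodule.mem_span_singleton_self s))) hb0
    · exact absurd (ha ha0 (Submodule.smul_mem _ _ (Submodule.mem_span_singleton_self s))) ha0
  | single n c =>
    have h1 : (MonoidAlgebra.single n c : k[M]) =
        MonoidAlgebra.single 1 c * MonoidAlgebra.single n 1 := by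
      rw [MonoidAlgebra.single_mul_single, one_mul, mul_one]
    have h2 : (MonoidAlgebra.single m (1 : k) : k[M]) * MonoidAlgebra.single 1 c =
        MonoidAlgebra.single 1 c * MonoidAlgebra.single m 1 := by
      rw [MonoidAlgebra.single_mul_single, MonoidAlgebra.single_mul_single, one_mul, mul_one,
        one_mul, mul_one]
    rw [h1, smul_smul, ← mul_assoc, h2, mul_assoc, MonoidAlgebra.single_mul_single, mul_smul,
      one_mul, h0, smul_zero]

/-- A simple module over the algebra of a finite monoid has an apex: an idempotent that does not
annihilate it and lies in `MmM` for each `m` that does not annihilate it. -/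
theorem exists_apex [Finite M] [IsSimpleModule k[M] S] :
    ∃ h : M, IsIdempotentElem h ∧ ActsNonzero k S h ∧
      ∀ m, ActsNonzero k S m → ∃ a b, h = a * m * b := by
  obtain ⟨m, hm, hmin⟩ := Set.Finite.exists_minimalFor
    (fun m : M => Set.ncard {x | ∃ a b, x = a * m * b}) {m | ActsNonzero k S m}
    (Set.toFinite _) ⟨1, by
      have := IsSimpleModule.nontrivial k[M] S
      obtain ⟨s, hs⟩ := exists_ne (0 : S)
      exact ⟨s, by rwa [← MonoidAlgebra.one_def, one_smul]⟩⟩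
  -- Minimality means that `m` is a multiple of each multiple of it that acts nonzero.
  have hmin' : ∀ a b, ActsNonzero k S (a * m * b) → ∃ c d, m = c * (a * m * b) * d := by
    intro a b hab
    have hsub : {x | ∃ c d, x = c * (a * m * b) * d} ⊆ {x | ∃ c d, x = c * m * d} := by
      rintro _ ⟨c, d, rfl⟩
      exact ⟨c * a, b * d, by simp only [mul_assoc]⟩
    have heq := Set.eq_of_subset_of_ncard_le hsub
      (hmin hab (Set.ncard_le_ncard hsub (Set.toFinite _))) (Set.toFinite _)
    exact heq.ge ⟨1, 1, by simp⟩
  have hprime : ∀ a b : M, ActsNonzero k S a → ActsNonzero k S b →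
      ∃ w, ActsNonzero k S (a * w * b) := by
    rintro a b ha ⟨s, hs⟩
    obtain ⟨w, hw⟩ := ha.exists_mul hs
    exact ⟨w, s, by rwa [← single_smul_single_smul]⟩
  obtain ⟨w, hw⟩ := hprime m m hm hm
  -- `m = (mw)^t m z^t` for suitable `z` and all `t`; for `t` with `(mw)^t` idempotent this is
  -- the required idempotent.
  obtain ⟨z, hz⟩ := right_stable ⟨w * m, (mul_assoc m w m)⟩ (by
    obtain ⟨c, d, hcd⟩ := hmin' (m * w) 1 (by rwa [mul_one])
    exact ⟨c, d, by rwa [mul_one] at hcd⟩)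
  obtain ⟨t, ht, hE⟩ := exists_isIdempotentElem_pow (m * w)
  have hpow : ∀ t, m = (m * w) ^ t * m * z ^ t := by
    intro t
    induction t with
    | zero => simp
    | succ t ih =>
      calc m = (m * w) ^ t * m * z ^ t := ih
        _ = (m * w) ^ t * (m * w * m * z) * z ^ t := by rw [← hz]
        _ = _ := by rw [pow_succ, pow_succ' z]; simp only [mul_assoc]
  have hfix : (m * w) ^ t * m = m := by
    calc (m * w) ^ t * m = (m * w) ^ t * ((m * w) ^ t * m * z ^ t) := by rw [← hpow t]
      _ = (m * w) ^ t * m * z ^ t := by rw [← mul_assoc, ← mul_assoc, hE]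
      _ = m := (hpow t).symm
  have hact : ActsNonzero k S ((m * w) ^ t) := by
    refine ActsNonzero.of_mul (m := 1) (n := m) ?_
    rwa [one_mul, hfix]
  refine ⟨(m * w) ^ t, hE, hact, fun m' hm' => ?_⟩
  obtain ⟨v, hv⟩ := hprime m' m hm' hm
  obtain ⟨c, d, hcd⟩ := hmin' (m' * v) 1 (by rwa [mul_one])
  obtain ⟨q, rfl⟩ := Nat.exists_eq_succ_of_ne_zero ht.ne'
  refine ⟨c, v * m * d * (w * (m * w) ^ q), ?_⟩
  rw [Nat.succ_eq_add_one, pow_succ']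
  generalize (m * w) ^ q = y
  calc m * w * y = c * (m' * v * m * 1) * d * w * y := by rw [← hcd]
    _ = _ := by simp only [mul_assoc, mul_one]

end Apex

section Radical

variable {M : Type u} [Monoid M] [Finite M] [IsRightFountain M] {k : Type v} [Field k]
  {V : Type w} [AddCommGroup V] [Module k V] {e : Idem M}
  (σ : Representation k (MaxSubgroup e) V)

/-- The kernel of the canonical homomorphism is killed by each homomorphism `θ` to a simple
module: `r θ(t)` with `r` in the apex only sees the terms `x ⊗ v` of `t` with `rx ∈ G_e`. -/
theorem eq_zero_of_headMap_eq_zero {S : Type*} [AddCommGroup S] [Module k[M] S]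
    [IsSimpleModule k[M] S] (θ : BalancedTensor (lTildeRight e k) σ →+ S)
    (hθ : ∀ m t, θ (lTildeTensor e σ m t) = MonoidAlgebra.single m (1 : k) • θ t)
    (t : BalancedTensor (lTildeRight e k) σ) (ht : headMap σ t = 0) : θ t = 0 := by
  by_contra hne
  obtain ⟨h, hidem, hact, hapex⟩ := exists_apex (M := M) (k := k) (S := S)
  -- If `h` is `J`-equivalent to `e`, it may be replaced by `e`.
  wlog hwlog : JRel h e → h = e generalizing h
  · push Not at hwlog
    obtain ⟨⟨a, b, hab⟩, ⟨c, d, hcd⟩⟩ := jRel_iff.mp hwlog.1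
    refine this (e : M) e.2 (ActsNonzero.of_mul (m := a) (n := b) (hab ▸ hact)) ?_ fun _ => rfl
    intro m hm
    obtain ⟨p, q, hpq⟩ := hapex m hm
    exact ⟨c * p, q * d, by rw [hcd, hpq]; simp only [mul_assoc]⟩
  obtain ⟨n, hn⟩ := hact.exists_mul hne
  have hr : h * (h * n) = h * n := by rw [← mul_assoc, hidem]
  have hrR : RRel (h * n) h := rRel_of_mul_left hr (hapex _ ⟨_, hn⟩)
  -- Only the terms `x ⊗ v` with `hnx ∈ G_e` survive the action of `hn`, and only if `h = e`.
  have hterm : ∀ (x : LTilde e) (v : V), θ (lTildeTensor e σ (h * n) (lTmul σ x v)) ≠ 0 →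
      h = e ∧ ∃ g : MaxSubgroup e, g.val = h * n * x.1 := by
    intro x v hxv
    have hx : LTildeRel (h * n * x.1) e := by
      by_contra hx
      exact hxv (by rw [lTildeTensor_lTmul_of_not σ hx, map_zero])
    have hR : RRel (h * n * x.1) h := by
      refine rRel_of_mul_left (by rw [← mul_assoc, hr])
        (hapex _ ⟨θ (lTmul σ (LTilde.base e) v), ?_⟩)
      rwa [lTmul_eq_base, hθ, hθ, single_smul_single_smul] at hxv
    obtain ⟨y, -, -, hy⟩ := hR.exists_regular hidem
    have hL := LTildeRel.lRel_of_regular e.2 hx hy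
    have he : h = e := hwlog (by
      have h1 := hR.jRel
      have h2 := hL.jRel
      unfold JRel at h1 h2 ⊢
      rw [← h1, h2])
    subst he
    exact ⟨rfl, exists_maxSubgroup_of_rRel hR (by rw [mul_assoc, LTilde.right_id x.2])⟩
  by_cases he : h = e
  · subst he
    let r : RClass e := ⟨e * n, hrR⟩
    have key : ∀ t, θ (lTildeTensor e σ (e * n) t) =
        θ (lTmul σ (LTilde.base e) (CoindSpace.eval σ r (headMap σ t))) := by
      refine lTmul_induction σ (by simp) (fun s t hs ht => by simp only [map_add, hs, ht]) ?_
      intro x v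
      rw [headMap_lTmul, eval_coindOf]
      by_cases hg : ∃ g : MaxSubgroup e, g.val = e * n * x.1
      · obtain ⟨g, hg⟩ := hg
        have h1 : LTildeRel (e * n * x.1) e := hg ▸ g.lRel.lTildeRel
        have h2 : (⟨_, h1⟩ : LTilde e) = MulOpposite.op g • LTilde.base e :=
          Subtype.ext (hg.symm.trans g.left_id.symm)
        rw [lTildeTensor_lTmul σ h1, h2, lTmul_smul]
        change _ = θ (lTmul σ _ (zeroExt σ (e * n * x.1) v))
        rw [← hg, zeroExt_val]
      · rw [zeroExt_of_not σ hg, LinearMap.zero_apply, map_zero, map_zero]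
        by_contra h0
        exact hg (hterm x v h0).2
    rw [← hθ, key, ht, map_zero, map_zero, map_zero] at hn
    exact hn rfl
  · have key : ∀ t, θ (lTildeTensor e σ (h * n) t) = 0 := by
      refine lTmul_induction σ (by simp) (fun s t hs ht => by
        simp only [map_add, hs, ht, add_zero]) ?_
      intro x v
      by_contra h0
      exact he (hterm x v h0).1
    exact hn (by rw [← hθ, key])

theorem ker_headHom_le : LinearMap.ker (headHom σ) ≤
    Module.jacobson k[M] (lTildeTensor e σ).asModule := by
  refine le_sInf fun N hN t ht => ?_
  have : IsSimpleModule k[M] ((lTildeTensor e σ).asModule ⧸ N) :=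
    isSimpleModule_iff_isCoatom.mpr hN
  refine (Submodule.Quotient.mk_eq_zero N).mp ?_
  refine eq_zero_of_headMap_eq_zero σ N.mkQ.toAddMonoidHom (fun m s => ?_) t ht
  let s' : (lTildeTensor e σ).asModule := s
  have h := map_smul N.mkQ (MonoidAlgebra.single m (1 : k)) s'
  rw [Representation.single_smul, one_smul] at h
  exact h

/-- A simple representation of a finite group is finite dimensional. -/
theorem finiteDimensional_of_isIrreducible {G : Type*} [Group G] [Finite G]
    (σ : Representation k G V) [σ.IsIrreducible] : FiniteDimensional k V := by
  have h := (Representation.irreducible_iff_isSimpleModule_asModule σ).mp inferInstance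
  have : Module.Finite k k[G] := Module.Finite.of_basis (MonoidAlgebra.basis G k)
  have h2 : Module.Finite k[G] σ.asModule := inferInstance
  have h3 : Module.Finite k σ.asModule := Module.Finite.trans k[G] _
  exact Module.Finite.equiv σ.asModuleEquiv

/-- Apart from projectivity, `k L̃_e ⊗ V` always satisfies the requirements on a projective cover
of `V^♯`. -/
theorem isProjectiveCover_iff [σ.IsIrreducible] :
    IsProjectiveCover k[M] (lTildeTensor e σ).asModule (sharp e σ) ↔
      Module.Projective k[M] (lTildeTensor e σ).asModule := by
  refine ⟨fun h => h.2.1, fun h => ⟨?_, h, ?_⟩⟩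
  · have : Finite (MaxSubgroup e) := Finite.of_injective _ MaxSubgroup.val_injective
    have := finiteDimensional_of_isIrreducible σ
    have h1 : Module.Finite k (BalancedTensor (lTildeRight e k) σ) :=
      Module.Finite.of_surjective (balancedMk (lTildeRight e k) σ) (Submodule.mkQ_surjective _)
    have h2 : Module.Finite k (lTildeTensor e σ).asModule := h1
    exact Module.Finite.of_restrictScalars_finite k _ _
  · rw [sharp_eq_range]
    refine ⟨(headHom σ).rangeRestrict, (headHom σ).surjective_rangeRestrict, ?_⟩
    rw [LinearMap.ker_rangeRestrict]
    exact ker_headHom_le σ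

end Radical

/-! ### Coinduced modules and the sandwich matrix -/

section Semisimple

variable {k : Type v} [Field k] {G : Type x} [Group G]

/-- Complete reducibility: a subspace containing the images of all homomorphisms from simple
modules is everything. -/
theorem mem_of_irreducible [Finite G] [NeZero (Nat.card G : k)] {W : Type w} [AddCommGroup W]
    [Module k W] (ρ : Representation k G W) (T : Submodule k W)
    (h : ∀ (V : Type w) [AddCommGroup V] [Module k V] (σ : Representation k G V),
      σ.IsIrreducible → ∀ (φ : σ.IntertwiningMap ρ) (v : V), φ v ∈ T) (x : W) : x ∈ T := by
  have hle : ∀ N : Submodule k[G] ρ.asModule, IsSimpleModule k[G] N →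
      ∀ y ∈ N, ρ.asModuleEquiv y ∈ T := by
    intro N hN y hy
    let N' := Subrepresentation.ofSubmodule' N
    let φ : N'.toRepresentation.IntertwiningMap ρ := ⟨N'.toSubmodule.subtype, fun g => rfl⟩
    have hirr : N'.toRepresentation.IsIrreducible := by
      rw [Representation.irreducible_iff_isSimpleModule_asModule]
      let ι : N'.toRepresentation.asModule →ₗ[k[G]] ρ.asModule :=
        Representation.IntertwiningMap.equivLinearMapAsModule _ _ φ
      have hι : Function.Injective ι := Subtype.val_injective
      have hr : LinearMap.range ι = N := by
        ext z
        exact ⟨by rintro ⟨y, rfl⟩; exact y.2, fun hz => ⟨⟨z, hz⟩, rfl⟩⟩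
      exact IsSimpleModule.congr ((LinearEquiv.ofInjective ι hι).trans (LinearEquiv.ofEq _ _ hr))
    exact h N'.toSubmodule N'.toRepresentation hirr φ ⟨y, hy⟩
  have htop : ρ.asModuleEquiv.symm x ∈
      ⨆ N : {N : Submodule k[G] ρ.asModule | IsSimpleModule k[G] N}, N.1 := by
    rw [← sSup_eq_iSup', IsSemisimpleModule.sSup_simples_eq_top]; trivial
  have := Submodule.iSup_induction _ (motive := fun y => ρ.asModuleEquiv y ∈ T) htop
    (fun N y hy => hle N.1 N.2 y hy) (by rw [map_zero]; exact T.zero_mem)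
    (fun y z hy hz => by rw [map_add]; exact T.add_mem hy hz)
  rwa [LinearEquiv.apply_symm_apply] at this

/-- The left regular representation of `G` on `kG`. -/
noncomputable def regRep (k : Type v) [Field k] (G : Type x) [Group G] :
    Representation k G k[G] :=
  Representation.ofModule' k[G]

theorem regRep_apply (g : G) (u : k[G]) : regRep k G g u = MonoidAlgebra.single g 1 * u := rfl

end Semisimple

section SandwichSurjective

variable {M : Type u} [Monoid M] {k : Type v} [Field k] {V : Type w} [AddCommGroup V] [Module k V]
  {e : Idem M} (σ : Representation k (MaxSubgroup e) V) (s : SandwichReps e)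

/-- The representative `lam b` as an element of `R_e`. -/
def SandwichReps.lamR (b : LClassesIn e) : RClass e := ⟨s.lam b, s.lam_RRel b⟩

theorem sandwichMatrix_of_eq {b : LClassesIn e} {a : RClassesIn e} {g : MaxSubgroup e}
    (h : g.val = s.lam b * s.rho a) : sandwichMatrix k s b a = MonoidAlgebra.single g 1 := by
  have h' : ∃ g : MaxSubgroup e, g.val = s.lam b * s.rho a := ⟨g, h⟩
  rw [sandwichMatrix, dif_pos h', MaxSubgroup.val_injective (h'.choose_spec.trans h.symm)]

theorem sandwichMatrix_of_not {b : LClassesIn e} {a : RClassesIn e}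
    (h : ¬ ∃ g : MaxSubgroup e, g.val = s.lam b * s.rho a) : sandwichMatrix k s b a = 0 :=
  dif_neg h

theorem sandwichMatrix_mul (φ : σ.IntertwiningMap (regRep k (MaxSubgroup e)))
    (b : LClassesIn e) (a : RClassesIn e) (v : V) :
    sandwichMatrix k s b a * φ v = φ (zeroExt σ (s.lam b * s.rho a) v) := by
  by_cases h : ∃ g : MaxSubgroup e, g.val = s.lam b * s.rho a
  · obtain ⟨g, hg⟩ := h
    rw [sandwichMatrix_of_eq s hg, ← hg, zeroExt_val, φ.isIntertwining, regRep_apply]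
  · rw [sandwichMatrix_of_not s h, zeroExt_of_not σ h, LinearMap.zero_apply, map_zero, zero_mul]

theorem SandwichReps.lam_injective {b c : LClassesIn e} (h : LRel (s.lam b) (s.lam c)) : b = c := by
  obtain ⟨m, -, hm⟩ := b.2
  obtain ⟨n, -, hn⟩ := c.2
  have h1 : LRel (s.lam b) m := by have := s.lam_mem b; rwa [hm] at this
  have h2 : LRel (s.lam c) n := by have := s.lam_mem c; rwa [hn] at this
  refine Subtype.ext ?_
  rw [hm, hn]
  have h3 : LRel m n := by
    unfold LRel at h h1 h2 ⊢
    rw [← h1, h, h2]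
  ext x
  simp only [Set.mem_ofPred_eq]
  unfold LRel at h3 ⊢
  rw [h3]

theorem SandwichReps.exists_rho [Finite M] {x : M} (hx : LRel x e) :
    ∃ (a : RClassesIn e) (g : MaxSubgroup e), x = s.rho a * g.val := by
  let a : RClassesIn e := ⟨{y | RRel y x}, x, hx.jRel, rfl⟩
  have h : RRel (s.rho a) x := s.rho_mem a
  obtain ⟨g, hg⟩ := exists_mul_val_of_lRel_of_rRel hx (s.rho_LRel a) (Eq.symm h)
  exact ⟨a, g, hg⟩

theorem SandwichReps.rho_right_id (a : RClassesIn e) : s.rho a * (e : M) = s.rho a := by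
  obtain ⟨⟨c, hc⟩, -⟩ := lRel_iff.mp (s.rho_LRel a)
  rw [hc, mul_assoc, e.2]

/-- The function in `Coind_{G_e}(V)` supported on the `G_e`-orbit of `lam c`, with value `v` at
`lam c`. -/
theorem exists_coind_delta (c : LClassesIn e) (v : V) :
    ∃ f : CoindSpace e σ, ∀ b,
      CoindSpace.eval σ (s.lamR b) f = if b = c then v else 0 := by
  classical
  have huniq : ∀ g g' : MaxSubgroup e, g • s.lamR c = g' • s.lamR c → g = g' := by
    intro g g' h
    obtain ⟨y, hy, -, -⟩ := (s.lam_RRel c).exists_regular e.2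
    have h1 : g.val * s.lam c = g'.val * s.lam c := congrArg Subtype.val h
    refine MaxSubgroup.val_injective ?_
    rw [← g.right_id, ← g'.right_id, ← hy, ← mul_assoc, ← mul_assoc, h1]
  let F : RClass e → V := fun r =>
    if h : ∃ g : MaxSubgroup e, g • s.lamR c = r then σ h.choose v else 0
  have hF : ∀ g : MaxSubgroup e, F (g • s.lamR c) = σ g v := by
    intro g
    have h : ∃ g' : MaxSubgroup e, g' • s.lamR c = g • s.lamR c := ⟨g, rfl⟩
    simp only [F, dif_pos h]
    rw [huniq _ _ h.choose_spec]
  have hF0 : ∀ r, (¬ ∃ g : MaxSubgroup e, g • s.lamR c = r) → F r = 0 := fun r h => dif_neg h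
  refine ⟨(⟨F, fun g r => ?_⟩ : coindV e σ), fun b => ?_⟩
  · by_cases h : ∃ g' : MaxSubgroup e, g' • s.lamR c = r
    · obtain ⟨g', rfl⟩ := h
      rw [← mul_smul, hF, hF, map_mul]; rfl
    · rw [hF0 r h, hF0, map_zero]
      rintro ⟨g', hg'⟩
      exact h ⟨g⁻¹ * g', by rw [mul_smul, hg', inv_smul_smul]⟩
  · change F (s.lamR b) = _
    split_ifs with hbc
    · subst hbc
      have := hF 1
      rwa [one_smul, map_one] at this
    · refine hF0 _ ?_
      rintro ⟨g, hg⟩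
      have h1 : g.val * s.lam c = s.lam b := congrArg Subtype.val hg
      refine hbc (s.lam_injective (lRel_iff.mpr ⟨⟨_, h1.symm⟩, ⟨g⁻¹.val, ?_⟩⟩))
      rw [← h1, ← mul_assoc, g.inv_mul_val]
      exact (s.lamR c).left_id.symm

variable [Finite M] [IsRightFountain M]

/-- In the coordinates given by the `lam b`, the image of the canonical homomorphism is contained
in the column space of the sandwich matrix. -/
theorem exists_eval_headMap (t : BalancedTensor (lTildeRight e k) σ) :
    ∃ z : RClassesIn e → V, ∀ b, CoindSpace.eval σ (s.lamR b) (headMap σ t) =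
      ∑ a, zeroExt σ (s.lam b * s.rho a) (z a) := by
  classical
  induction t using lTmul_induction with
  | zero => exact ⟨0, fun b => by simp⟩
  | add t t' h h' =>
    obtain ⟨z, hz⟩ := h
    obtain ⟨z', hz'⟩ := h'
    refine ⟨z + z', fun b => ?_⟩
    simp only [map_add, hz, hz', Pi.add_apply, Finset.sum_add_distrib]
  | lTmul x v =>
    by_cases hx : LRel x.1 e
    · obtain ⟨a, g, hg⟩ := s.exists_rho hx
      refine ⟨Pi.single a (σ g v), fun b => ?_⟩
      rw [Finset.sum_eq_single a, headMap_lTmul, eval_coindOf, Pi.single_eq_same, hg, ← mul_assoc,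
        zeroExt_mul_val σ g (by rw [mul_assoc, s.rho_right_id])]
      · rfl
      · intro a' _ ha'
        rw [Pi.single_eq_of_ne ha', map_zero]
      · simp
    · refine ⟨0, fun b => ?_⟩
      rw [headMap_lTmul, eval_coindOf, zeroExt_of_not]
      · simp
      · rintro ⟨g, hg⟩
        exact hx (lRel_of_mul_eq_val (LTilde.right_id x.2) hg)

/-- If all coinduced modules are images of the canonical homomorphisms, then the sandwich matrix
is right invertible. -/
theorem isRightInvertible_of_surjective [NeZero (Nat.card (MaxSubgroup e) : k)]
    (h : ∀ (V : Type (max u v)) [AddCommGroup V] [Module k V]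
      (σ : Representation k (MaxSubgroup e) V), σ.IsIrreducible →
        Function.Surjective (headMap σ)) :
    IsRightInvertible (sandwichMatrix k s) := by
  have : Finite (MaxSubgroup e) := Finite.of_injective _ MaxSubgroup.val_injective
  have key : ∀ c : LClassesIn e, ∃ z : RClassesIn e → k[MaxSubgroup e],
      ∀ b, ∑ a, sandwichMatrix k s b a * z a = if b = c then 1 else 0 := by
    intro c
    let T : Submodule k k[MaxSubgroup e] :=
      { carrier := {u | ∃ z : RClassesIn e → k[MaxSubgroup e],
          ∀ b, ∑ a, sandwichMatrix k s b a * z a = if b = c then u else 0}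
        add_mem' := by
          rintro u u' ⟨z, hz⟩ ⟨z', hz'⟩
          refine ⟨z + z', fun b => ?_⟩
          simp only [Pi.add_apply, mul_add, Finset.sum_add_distrib, hz, hz']
          split_ifs <;> simp
        zero_mem' := ⟨0, fun b => by simp⟩
        smul_mem' := by
          rintro d u ⟨z, hz⟩
          refine ⟨d • z, fun b => ?_⟩
          simp only [Pi.smul_apply, mul_smul_comm, ← Finset.smul_sum, hz]
          split_ifs <;> simp }
    refine mem_of_irreducible (regRep k (MaxSubgroup e)) T ?_ 1
    intro V _ _ σ hσ φ v
    obtain ⟨f, hf⟩ := exists_coind_delta σ s c v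
    obtain ⟨t, rfl⟩ := h V σ hσ f
    obtain ⟨z, hz⟩ := exists_eval_headMap σ s t
    refine ⟨fun a => φ (z a), fun b => ?_⟩
    simp only [sandwichMatrix_mul, ← map_sum, ← hz, hf]
    split_ifs
    · rfl
    · exact map_zero φ
  choose Q hQ using key
  refine ⟨Matrix.of fun a c => Q c a, ?_⟩
  ext1 b c
  rw [Matrix.mul_apply, Matrix.one_apply]
  exact hQ c b

end SandwichSurjective

/-! ### Projectivity of the modules `k L̃_e ⊗ V` implies simplicity of the coinduced modules -/

section Lift

variable {M : Type u} [Monoid M] {k : Type v} [Field k] {V : Type w} [AddCommGroup V] [Module k V]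

/-- The homomorphism `kM → U` sending `a` to `a • w`. -/
noncomputable def orbitHom {U : Type*} [AddCommGroup U] [Module k U] (ρ : Representation k M U)
    (w : U) : k[M] →ₗ[k[M]] ρ.asModule :=
  LinearMap.toSpanSingleton k[M] ρ.asModule (ρ.asModuleEquiv.symm w)

theorem orbitHom_single {U : Type*} [AddCommGroup U] [Module k U] (ρ : Representation k M U)
    (w : U) (m : M) (c : k) : orbitHom ρ w (MonoidAlgebra.single m c) = c • ρ m w := by
  change (MonoidAlgebra.single m c : k[M]) • (ρ.asModuleEquiv.symm w) = _
  rw [Representation.single_smul, LinearEquiv.apply_symm_apply]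

variable {e : Idem M}

theorem orbitHom_base_surjective :
    Function.Surjective (orbitHom (lTildeLeft e k) (Finsupp.single (LTilde.base e) 1)) := by
  intro (y : LTilde e →₀ k)
  induction y using Finsupp.induction_linear with
  | zero => exact ⟨0, map_zero _⟩
  | add y z hy hz =>
    obtain ⟨a, ha⟩ := hy
    obtain ⟨b, hb⟩ := hz
    exact ⟨a + b, by rw [map_add, ha, hb]; rfl⟩
  | single x c =>
    refine ⟨MonoidAlgebra.single x.1 c, ?_⟩
    have h : x.1 * (LTilde.base e).1 = x.1 := LTilde.right_id x.2
    have h' : LTildeRel (x.1 * (LTilde.base e).1) e := by rw [h]; exact x.2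
    have h2 : (⟨_, h'⟩ : LTilde e) = x := Subtype.ext h
    rw [orbitHom_single, lTildeLeft_single h', h2]
    exact (Finsupp.smul_single_one x c)

/-- The image of `a` in `k L̃_e` records the coefficients of `a e` on `L̃_e`. -/
theorem mul_idem_sub_mem (a : k[M]) :
    a * MonoidAlgebra.single (e : M) 1 - Finsupp.linearCombination k
      (fun x : LTilde e => (MonoidAlgebra.single x.1 1 : k[M]))
      ((lTildeLeft e k).asAlgebraHom a (Finsupp.single (LTilde.base e) 1)) ∈
    Submodule.span k {y : k[M] | ∃ x : M, x * e = x ∧ ¬ LTildeRel x e ∧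
      y = MonoidAlgebra.single x 1} := by
  induction a using MonoidAlgebra.induction_linear with
  | zero => simp
  | add a b ha hb =>
    have := add_mem ha hb
    rw [← add_sub_add_comm, ← add_mul] at this
    rwa [map_add, LinearMap.add_apply, map_add]
  | single m c =>
    rw [MonoidAlgebra.single_mul_single, mul_one, Representation.asAlgebraHom_single,
      LinearMap.smul_apply, map_smul]
    have h2 : (MonoidAlgebra.single (m * e) c : k[M]) = c • MonoidAlgebra.single (m * e) 1 := by
      rw [MonoidAlgebra.smul_single, smul_eq_mul, mul_one]
    rw [h2, ← smul_sub]
    refine Submodule.smul_mem _ _ ?_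
    by_cases h : LTildeRel (m * e) e
    · have h' : LTildeRel (m * (LTilde.base e).1) e := h
      rw [lTildeLeft_single h', Finsupp.linearCombination_single, one_smul]
      change MonoidAlgebra.single (m * (e : M)) 1 - MonoidAlgebra.single (m * (e : M)) 1 ∈ _
      rw [sub_self]
      exact zero_mem _
    · have h' : ¬ LTildeRel (m * (LTilde.base e).1) e := h
      rw [lTildeLeft_single_of_not h', map_zero, sub_zero]
      exact Submodule.subset_span ⟨m * e, by rw [mul_assoc, e.2], h, rfl⟩

variable (σ : Representation k (MaxSubgroup e) V) [IsRightFountain M]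

/-- The right action of `kG_e` on a basis element of `k L̃_e`. -/
noncomputable def lTildeMul (k : Type v) [Field k] (x : LTilde e) :
    k[MaxSubgroup e] →ₗ[k] (LTilde e →₀ k) :=
  (Finsupp.lmapDomain k k fun g : MaxSubgroup e => MulOpposite.op g • x) ∘ₗ
    (MonoidAlgebra.coeffLinearEquiv k).toLinearMap

theorem lTildeMul_single (x : LTilde e) (g : MaxSubgroup e) (c : k) :
    lTildeMul k x (MonoidAlgebra.single g c) = Finsupp.single (MulOpposite.op g • x) c :=
  Finsupp.mapDomain_single

theorem lTildeMul_smul (x : LTilde e) (g : MaxSubgroup e) (u : k[MaxSubgroup e]) :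
    lTildeMul k (MulOpposite.op g • x) u = lTildeMul k x (MonoidAlgebra.single g 1 * u) := by
  induction u using MonoidAlgebra.induction_linear with
  | zero => simp
  | add u v hu hv => rw [mul_add, map_add, map_add, hu, hv]
  | single h c =>
    rw [MonoidAlgebra.single_mul_single, lTildeMul_single, lTildeMul_single, one_mul,
      MulOpposite.op_mul, mul_smul]

theorem lTildeLeft_lTildeMul {m : M} {x : LTilde e} (h : LTildeRel (m * x.1) e)
    (u : k[MaxSubgroup e]) :
    lTildeLeft e k m (lTildeMul k x u) = lTildeMul k ⟨m * x.1, h⟩ u := by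
  induction u using MonoidAlgebra.induction_linear with
  | zero => simp
  | add u v hu hv => rw [map_add, map_add, map_add, hu, hv]
  | single g c =>
    rw [lTildeMul_single, lTildeMul_single,
      lTildeLeft_single ((LTilde.mul_smul_iff _ _ _).mpr h)]
    congr 1
    exact Subtype.ext (mul_assoc _ _ _).symm

theorem lTildeLeft_lTildeMul_of_not {m : M} {x : LTilde e} (h : ¬ LTildeRel (m * x.1) e)
    (u : k[MaxSubgroup e]) :
    lTildeLeft e k m (lTildeMul k x u) = 0 := by
  induction u using MonoidAlgebra.induction_linear with
  | zero => simp
  | add u v hu hv => rw [map_add, map_add, hu, hv, add_zero]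
  | single g c =>
    rw [lTildeMul_single, lTildeLeft_single_of_not ((LTilde.mul_smul_iff _ _ _).not.mpr h)]

/-- A homomorphism `φ : V → kG_e` induces `k L̃_e ⊗ V → k L̃_e`, `x ⊗ v ↦ xφ(v)`. -/
theorem exists_tensor_hom (φ : σ.IntertwiningMap (regRep k (MaxSubgroup e))) :
    ∃ μ : (lTildeTensor e σ).IntertwiningMap (lTildeLeft e k),
      ∀ x v, μ (lTmul σ x v) = lTildeMul k x (φ v) := by
  let f := balancedLift (lTildeRight e k) σ (TensorProduct.lift
    (Finsupp.linearCombination k fun x : LTilde e => lTildeMul k x ∘ₗ φ.toLinearMap)) (by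
      intro a g v
      rw [TensorProduct.lift.tmul, TensorProduct.lift.tmul]
      induction a using Finsupp.induction_linear with
      | zero => simp
      | add a b ha hb => simp only [map_add, LinearMap.add_apply, ha, hb]
      | single x c =>
        rw [lTildeRight_single, Finsupp.linearCombination_single,
          Finsupp.linearCombination_single, LinearMap.smul_apply, LinearMap.smul_apply]
        change c • lTildeMul k (MulOpposite.op g • x) (φ v) = c • lTildeMul k x (φ (σ g v))
        rw [lTildeMul_smul, φ.isIntertwining, regRep_apply])
  have hf : ∀ x v, f (lTmul σ x v) = lTildeMul k x (φ v) := by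
    intro x v
    change TensorProduct.lift _ (Finsupp.single x (1 : k) ⊗ₜ[k] v) = _
    simp
  refine ⟨⟨f, fun m => lTildeTensor_hom_ext σ fun x v => ?_⟩, hf⟩
  rw [LinearMap.comp_apply, LinearMap.comp_apply, hf]
  by_cases h : LTildeRel (m * x.1) e
  · rw [lTildeTensor_lTmul σ h, hf, lTildeLeft_lTildeMul h]
  · rw [lTildeTensor_lTmul_of_not σ h, map_zero, lTildeLeft_lTildeMul_of_not h]

/-- If the modules `k L̃_e ⊗ V` with `V` simple are projective, then the epimorphism
`kM → k L̃_e` splits: there is `ε ∈ e kM` annihilated from the left by all idempotents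
strictly `L`-below `e`, whose image is the basis element `e`. -/
theorem exists_lift_of_projective [Finite M] [NeZero (Nat.card (MaxSubgroup e) : k)]
    (h : ∀ (V : Type (max u v)) [AddCommGroup V] [Module k V]
      (σ : Representation k (MaxSubgroup e) V), σ.IsIrreducible →
        Module.Projective k[M] (lTildeTensor e σ).asModule) :
    ∃ ε : k[M], (∀ f : M, IsIdempotentElem f → f * e = f → (e : M) * f ≠ e →
        MonoidAlgebra.single f (1 : k) * ε = 0) ∧
      MonoidAlgebra.single (e : M) (1 : k) * ε = ε ∧
      (lTildeLeft e k).asAlgebraHom ε (Finsupp.single (LTilde.base e) 1) =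
        Finsupp.single (LTilde.base e) (1 : k) := by
  have : Finite (MaxSubgroup e) := Finite.of_injective _ MaxSubgroup.val_injective
  let π := orbitHom (lTildeLeft e k) (Finsupp.single (LTilde.base e) 1)
  let T : Submodule k k[MaxSubgroup e] :=
    { carrier := {u | ∃ ε : k[M], (∀ f : M, IsIdempotentElem f → f * e = f → (e : M) * f ≠ e →
        MonoidAlgebra.single f (1 : k) * ε = 0) ∧
        MonoidAlgebra.single (e : M) (1 : k) * ε = ε ∧
        π ε = lTildeMul k (LTilde.base e) u}
      add_mem' := by
        rintro u u' ⟨ε, h1, h2, h3⟩ ⟨ε', h1', h2', h3'⟩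
        refine ⟨ε + ε', fun f hf hfe hne => ?_, ?_, ?_⟩
        · rw [mul_add, h1 f hf hfe hne, h1' f hf hfe hne, add_zero]
        · rw [mul_add, h2, h2']
        · rw [map_add, h3, h3', map_add]; rfl
      zero_mem' := ⟨0, by simp, by simp, by rw [map_zero, map_zero]; rfl⟩
      smul_mem' := by
        rintro c u ⟨ε, h1, h2, h3⟩
        refine ⟨c • ε, fun f hf hfe hne => ?_, ?_, ?_⟩
        · rw [mul_smul_comm, h1 f hf hfe hne, smul_zero]
        · rw [mul_smul_comm, h2]
        · rw [LinearMap.map_smul_of_tower, h3, map_smul]; rfl }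
  have h1 : (1 : k[MaxSubgroup e]) ∈ T := by
    refine mem_of_irreducible (regRep k (MaxSubgroup e)) T ?_ 1
    intro V _ _ σ hσ φ v
    have := h V σ hσ
    obtain ⟨μ, hμ⟩ := exists_tensor_hom σ φ
    obtain ⟨s, hs⟩ := Module.projective_lifting_property π
      (Representation.IntertwiningMap.equivLinearMapAsModule _ _ μ) orbitHom_base_surjective
    let t : (lTildeTensor e σ).asModule := lTmul σ (LTilde.base e) v
    have ht : ∀ m : M, MonoidAlgebra.single m (1 : k) * s t =
        s (lTildeTensor e σ m (lTmul σ (LTilde.base e) v) : (lTildeTensor e σ).asModule) := by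
      intro m
      rw [← smul_eq_mul, ← map_smul, Representation.single_smul, one_smul]; rfl
    refine ⟨s t, fun f hf hfe hne => ?_, ?_, ?_⟩
    · rw [ht, lTildeTensor_lTmul_of_not]
      · exact map_zero s
      · intro hrel
        have hrel' : LTildeRel f e := by rw [← hfe]; exact hrel
        exact hne ((hrel' f hf).mp hf)
    · rw [ht]
      exact congrArg s (lTmul_eq_base σ (LTilde.base e) v).symm
    · exact (LinearMap.congr_fun hs t).trans (hμ _ _)
  obtain ⟨ε, h1, h2, h3⟩ := h1
  refine ⟨ε, h1, h2, h3.trans ?_⟩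
  rw [MonoidAlgebra.one_def, lTildeMul_single]
  congr 1
  exact one_smul _ _

end Lift

section Vanishing

variable {M : Type u} [Monoid M] {k : Type v} [Field k]

/-- An element of `f Coind_{G_e}(V)` that is killed by all idempotents strictly `L`-below `f`
vanishes, unless `f` is `J`-equivalent to `e`. -/
theorem coind_eq_zero {V : Type w} [AddCommGroup V] [Module k V] {e f : Idem M}
    (σ : Representation k (MaxSubgroup e) V)
    (hne : ¬ JRel (e : M) f) (w : CoindSpace e σ) (hw : coind e σ f w = w)
    (hlt : ∀ h : M, IsIdempotentElem h → h * f = h → (f : M) * h ≠ f → coind e σ h w = 0) :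
    w = 0 := by
  refine CoindSpace.ext σ fun r => ?_
  rw [map_zero, ← hw]
  by_cases hr : RRel (r.1 * (f : M)) e
  · rw [coind_eval_of_rRel σ hr]
    obtain ⟨y, -, -, hy⟩ := hr.exists_regular e.2
    have hidem : IsIdempotentElem (y * (r.1 * f)) := by
      unfold IsIdempotentElem
      rw [mul_assoc y, ← mul_assoc _ y, hy]
    have hf : y * (r.1 * f) * f = y * (r.1 * f) := by simp only [mul_assoc, f.2.eq]
    by_cases h : (f : M) * (y * (r.1 * f)) = f
    · refine absurd ?_ hne
      have h1 : JRel (r.1 * (f : M)) f :=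
        jRel_iff.mpr ⟨⟨r.1, 1, by simp⟩, ⟨f * y, 1, by rw [mul_one, mul_assoc, h]⟩⟩
      have h2 := hr.jRel
      unfold JRel at h1 h2 ⊢
      rw [← h1, h2]
    · have h0 := congrArg (CoindSpace.eval σ ⟨_, hr⟩) (hlt _ hidem hf h)
      have h1 : r.1 * (f : M) * (y * (r.1 * f)) = r.1 * f := by rw [← mul_assoc, hy]
      have h2 : RRel (r.1 * (f : M) * (y * (r.1 * f))) e := by rw [h1]; exact hr
      have h3 : (⟨_, h2⟩ : RClass e) = ⟨_, hr⟩ := Subtype.ext h1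
      rwa [coind_eval_of_rRel σ (r := ⟨_, hr⟩) h2, h3, map_zero] at h0
  · rw [coind_eval_of_not σ hr]

end Vanishing

section Generation

variable {M : Type u} [Monoid M] [IsRightFountain M] {k : Type v} [Field k]

/-- An element of `Me` outside `L̃_e` has a right identity strictly `L`-below `e`. -/
theorem exists_idem_lt {e x : M} (hidem : IsIdempotentElem e) (hx : x * e = x)
    (hne : ¬ LTildeRel x e) :
    ∃ f, IsIdempotentElem f ∧ x * f = x ∧ f * e = f ∧ e * f ≠ e := by
  obtain ⟨f, hf, hfx⟩ := IsRightFountain.exists_idem x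
  have h1 : f * e = f := (hfx e hidem).mpr hx
  refine ⟨f, hf, (hfx f hf).mp hf, h1, fun h2 => hne ?_⟩
  exact hfx.symm.trans (lRel_iff.mpr ⟨⟨f, h1.symm⟩, ⟨e, h2.symm⟩⟩).lTildeRel

variable [Finite M]

/-- Lifts of the basis elements `e_i`, one for each regular `J`-class, generate `kM` as a
two-sided ideal. -/
theorem one_mem_of_lifts {ι : Type*} (e : ι → Idem M) (he : ∀ f : Idem M, ∃ i, JRel (f : M) (e i))
    (ε : ι → k[M])
    (hε : ∀ i, (lTildeLeft (e i) k).asAlgebraHom (ε i) (Finsupp.single (LTilde.base (e i)) 1) =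
        Finsupp.single (LTilde.base (e i)) (1 : k))
    (T : Submodule k k[M]) (hl : ∀ m t, t ∈ T → MonoidAlgebra.single m 1 * t ∈ T)
    (hr : ∀ m t, t ∈ T → t * MonoidAlgebra.single m 1 ∈ T) (hT : ∀ i, ε i ∈ T) : 1 ∈ T := by
  suffices H : ∀ (n : ℕ) (f : M), IsIdempotentElem f → Set.ncard {x | ∃ a b, x = a * f * b} = n →
      MonoidAlgebra.single f 1 ∈ T from H _ 1 IsIdempotentElem.one rfl
  intro n
  induction n using Nat.strong_induction_on with
  | _ n ih =>
  intro f hf hn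
  obtain ⟨i, hi⟩ := he ⟨f, hf⟩
  have hle : Submodule.span k {y : k[M] | ∃ x : M, x * e i = x ∧ ¬ LTildeRel x (e i) ∧
      y = MonoidAlgebra.single x 1} ≤ T := by
    refine Submodule.span_le.mpr ?_
    rintro _ ⟨x, hx, hne, rfl⟩
    obtain ⟨h, hh, hxh, hhe, heh⟩ := exists_idem_lt (e i).2 hx hne
    have hlt : {y | ∃ a b, y = a * h * b} ⊂ {y | ∃ a b, y = a * f * b} := by
      unfold JRel at hi
      rw [hi]
      refine ⟨?_, fun hsub => heh ?_⟩
      · rintro _ ⟨a, b, rfl⟩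
        exact ⟨a * h, b, by rw [mul_assoc a h (e i : M), hhe]⟩
      · obtain ⟨a, b, hab⟩ := @hsub (e i : M) ⟨1, 1, by simp⟩
        obtain ⟨z, hz⟩ := left_stable (b := (e i : M)) ⟨h, hhe.symm⟩ ⟨a, b, hab⟩
        rw [hz, mul_assoc, hh]
    have hmem := hl x _ (ih _ (hn ▸ Set.ncard_lt_ncard hlt (Set.toFinite _)) h hh rfl)
    rwa [MonoidAlgebra.single_mul_single, hxh, one_mul] at hmem
  have hei : MonoidAlgebra.single (e i : M) 1 ∈ T := by
    have h1 := hle (mul_idem_sub_mem (ε i))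
    rw [hε] at h1
    have h2 := T.sub_mem (hr (e i) _ (hT i)) h1
    rwa [sub_sub_cancel, Finsupp.linearCombination_single, one_smul] at h2
  obtain ⟨⟨a, b, hab⟩, -⟩ := jRel_iff.mp hi
  have := hr b _ (hl a _ hei)
  rw [MonoidAlgebra.single_mul_single, MonoidAlgebra.single_mul_single, one_mul, one_mul] at this
  rwa [show f = a * (e i) * b from hab]

variable {V : Type w} [AddCommGroup V] [Module k V]

/-- If all modules `k L̃_e ⊗ V` with `V` simple are projective, then all canonical homomorphisms
to coinduced modules are surjective. -/
theorem headMap_surjective_of_projective {ι : Type*} (e : ι → Idem M)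
    (hchar : ∀ i, NeZero (Nat.card (MaxSubgroup (e i)) : k))
    (he : ∀ f : Idem M, ∃! i, JRel (f : M) (e i))
    (h : ∀ (i : ι) (V : Type (max u v)) [AddCommGroup V] [Module k V]
      (σ : Representation k (MaxSubgroup (e i)) V), σ.IsIrreducible →
        Module.Projective k[M] (lTildeTensor (e i) σ).asModule)
    (i : ι) (σ : Representation k (MaxSubgroup (e i)) V) : Function.Surjective (headMap σ) := by
  have hex := fun j => exists_lift_of_projective (e := e j) (h j)
  choose ε hε1 hε2 hε3 using hex
  let T : Submodule k k[M] :=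
    { carrier := {a | ∀ w, (coind (e i) σ).asAlgebraHom a w ∈ (headMap σ).range.toSubmodule}
      add_mem' := fun ha hb w => by
        rw [map_add]; exact Submodule.add_mem _ (ha w) (hb w)
      zero_mem' := fun w => by rw [map_zero]; exact Submodule.zero_mem _
      smul_mem' := fun c a ha w => by
        rw [map_smul]; exact Submodule.smul_mem _ _ (ha w) }
  have h1 : (1 : k[M]) ∈ T := by
    refine one_mem_of_lifts e (fun f => (he f).exists) ε hε3 T ?_ ?_ ?_
    · intro m t ht w
      rw [map_mul, Representation.asAlgebraHom_single, one_smul]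
      exact (headMap σ).range.apply_mem_toSubmodule m (ht w)
    · intro m t ht w
      rw [map_mul, Representation.asAlgebraHom_single, one_smul]
      exact ht _
    · intro j w
      have hact : ∀ m : M, (coind (e i) σ) m ((coind (e i) σ).asAlgebraHom (ε j) w) =
          (coind (e i) σ).asAlgebraHom (MonoidAlgebra.single m 1 * ε j) w := by
        intro m
        rw [map_mul, Representation.asAlgebraHom_single, one_smul]; rfl
      by_cases hij : i = j
      · subst hij
        rw [← hε2, ← hact]
        exact coind_idem_mem_range σ _
      · have h0 : (coind (e i) σ).asAlgebraHom (ε j) w = 0 := by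
          refine coind_eq_zero (f := e j) σ ?_ _ (by rw [hact, hε2]) ?_
          · intro hJ
            exact hij ((he (e i)).unique rfl hJ)
          · intro f hf hfe hne
            rw [hact, hε1 j f hf hfe hne, map_zero, LinearMap.zero_apply]
        rw [h0]
        exact Submodule.zero_mem _
  intro w
  have := h1 w
  rw [map_one] at this
  exact this

end Generation

/-! ### The associated graded module of `kM` -/

section Graded

variable {M : Type u} [Monoid M]

theorem LTildeRel.lRel_of_regular_of_regular {x x' y y' : M} (h : LTildeRel x x')
    (hx : x * y * x = x) (hx' : x' * y' * x' = x') : LRel x x' := by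
  have key : ∀ {x x' y' : M}, LTildeRel x x' → x' * y' * x' = x' → ∃ a, x = a * x' := by
    intro x x' y' h hx'
    have hi : IsIdempotentElem (y' * x') := by
      unfold IsIdempotentElem
      rw [mul_assoc y', ← mul_assoc x', hx']
    exact ⟨x * y', by rw [mul_assoc, (h _ hi).mpr (by rw [← mul_assoc, hx'])]⟩
  exact lRel_iff.mpr ⟨key h hx', key h.symm hx⟩

theorem LTildeRel.mul_congr {m n x : M} (h : LTildeRel (n * x) x) :
    LTildeRel (m * (n * x)) (n * x) ↔ LTildeRel (m * n * x) x := by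
  rw [mul_assoc]
  exact ⟨fun h' => h'.trans h, fun h' => h'.trans h.symm⟩

open Classical in
/-- The space `kM` with the action in which `m` sends a basis element `x` to `mx` if
`mx` is `L̃`-related to `x`, and to `0` otherwise. It is the direct sum of the modules `k L̃_x` over
the `L̃`-classes. -/
noncomputable def gradedRep (k : Type v) [Field k] (M : Type u) [Monoid M] :
    Representation k M (M →₀ k) where
  toFun m := Finsupp.linearCombination k fun x : M =>
    if LTildeRel (m * x) x then Finsupp.single (m * x) (1 : k) else 0
  map_one' := by
    ext1 x
    ext1
    have h : LTildeRel x x := fun _ _ => Iff.rfl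
    simp [h]
  map_mul' m n := by
    ext1 x
    ext1
    by_cases h1 : LTildeRel (n * x) x
    · have h2 := LTildeRel.mul_congr (m := m) h1
      by_cases h : LTildeRel (m * n * x) x
      · have h3 : LTildeRel (m * (n * x)) x := by rw [← mul_assoc]; exact h
        simp [h1, h2.mpr h, h3, mul_assoc]
      · simp [h1, h, mt h2.mp h]
    · have h : ¬ LTildeRel (m * n * x) x := fun h => h1 h.of_mul_mul
      simp [h1, h]

variable {k : Type v} [Field k]

theorem gradedRep_single {m x : M} (h : LTildeRel (m * x) x) (c : k) :
    gradedRep k M m (Finsupp.single x c) = Finsupp.single (m * x) c := by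
  simp [gradedRep, h]

theorem gradedRep_single_of_not {m x : M} (h : ¬ LTildeRel (m * x) x) (c : k) :
    gradedRep k M m (Finsupp.single x c) = 0 := by
  simp [gradedRep, h]

/-- `k L̃_e` is a direct summand of the graded module. -/
theorem projective_lTildeLeft (e : Idem M) (h : Module.Projective k[M] (gradedRep k M).asModule) :
    Module.Projective k[M] (lTildeLeft e k).asModule := by
  classical
  let i : (lTildeLeft e k).IntertwiningMap (gradedRep k M) :=
    ⟨Finsupp.lmapDomain k k Subtype.val, fun m => by
      ext1 x
      ext1
      simp only [LinearMap.comp_apply, Finsupp.lsingle_apply, Finsupp.lmapDomain_apply,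
        Finsupp.mapDomain_single]
      by_cases h : LTildeRel (m * x.1) e
      · rw [lTildeLeft_single h, Finsupp.mapDomain_single, gradedRep_single (h.trans x.2.symm)]
      · rw [lTildeLeft_single_of_not h, Finsupp.mapDomain_zero,
          gradedRep_single_of_not fun h' => h (h'.trans x.2)]⟩
  let p : (M →₀ k) →ₗ[k] (LTilde e →₀ k) := Finsupp.linearCombination k fun x : M =>
    if h : LTildeRel x e then Finsupp.single (⟨x, h⟩ : LTilde e) (1 : k) else 0
  have hp : ∀ (x : M) (h : LTildeRel x e), p (Finsupp.single x 1) = Finsupp.single ⟨x, h⟩ 1 := by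
    intro x h
    simp [p, h]
  have hp0 : ∀ (x : M) (_ : ¬ LTildeRel x e), p (Finsupp.single x 1) = 0 := by
    intro x h
    simp [p, h]
  let s : (gradedRep k M).IntertwiningMap (lTildeLeft e k) := ⟨p, fun m => by
    ext1 x
    ext1
    simp only [LinearMap.comp_apply, Finsupp.lsingle_apply]
    by_cases hx : LTildeRel x e
    · rw [hp x hx]
      by_cases h : LTildeRel (m * x) x
      · rw [gradedRep_single h, hp _ (h.trans hx), lTildeLeft_single (h.trans hx)]
      · have h' : ¬ LTildeRel (m * x) e := fun h' => h (h'.trans hx.symm)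
        rw [gradedRep_single_of_not h, map_zero, lTildeLeft_single_of_not h']
    · rw [hp0 x hx, map_zero]
      by_cases h : LTildeRel (m * x) x
      · rw [gradedRep_single h, hp0 _ fun h' => hx (h.symm.trans h')]
      · rw [gradedRep_single_of_not h, map_zero]⟩
  refine Module.Projective.of_split
    (Representation.IntertwiningMap.equivLinearMapAsModule _ _ i)
    (Representation.IntertwiningMap.equivLinearMapAsModule _ _ s) (LinearMap.ext ?_)
  have hsi : p ∘ₗ Finsupp.lmapDomain k k Subtype.val = LinearMap.id := by
    ext1 x
    ext1
    simp only [LinearMap.comp_apply, Finsupp.lsingle_apply, Finsupp.lmapDomain_apply,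
        Finsupp.mapDomain_single, LinearMap.id_apply]
    exact hp x.1 x.2
  exact fun t => LinearMap.congr_fun hsi t

variable [Finite M]

/-- If the graded module is cyclic, then it is free of rank one, for dimension reasons. -/
theorem projective_gradedRep_of_cyclic (d : M →₀ k)
    (hd : Function.Surjective (orbitHom (gradedRep k M) d)) :
    Module.Projective k[M] (gradedRep k M).asModule := by
  let f : k[M] →ₗ[k] (M →₀ k) :=
    LinearMap.applyₗ d ∘ₗ (gradedRep k M).asAlgebraHom.toLinearMap
  have hf : Function.Surjective f := hd
  have : Module.Finite k k[M] := Module.Finite.of_basis (MonoidAlgebra.basis M k)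
  have hinj : Function.Injective f :=
    (LinearMap.injective_iff_surjective_of_finrank_eq_finrank
      (MonoidAlgebra.coeffLinearEquiv k (M := M) (S := k)).finrank_eq).mpr hf
  exact Module.Projective.of_equiv (LinearEquiv.ofBijective (orbitHom (gradedRep k M) d) ⟨hinj, hd⟩)

end Graded

section Averaging

variable {M : Type u} [Monoid M] [Finite M] [IsRightFountain M] {k : Type v} [Field k]
  {V : Type w} [AddCommGroup V] [Module k V] {e : Idem M}
  (σ : Representation k (MaxSubgroup e) V)

/-- Tensoring with a vector space preserves projectivity. -/
theorem projective_tprod_one {M : Type*} [Monoid M] {U : Type*} [AddCommGroup U] [Module k U]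
    (ρ : Representation k M U) (h : Module.Projective k[M] ρ.asModule) (V : Type*) [AddCommGroup V]
    [Module k V] : Module.Projective k[M] (ρ.tprod (1 : Representation k M V)).asModule := by
  let F : ρ.asModule ⊗[k] V ≃ₗ[k[M]] (ρ.tprod (1 : Representation k M V)).asModule :=
    { AddEquiv.refl (U ⊗[k] V) with
      map_smul' := by
        intro r (t : ρ.asModule ⊗[k] V)
        induction t using TensorProduct.induction_on with
        | zero =>
          rw [smul_zero]
          exact (smul_zero (A := (ρ.tprod (1 : Representation k M V)).asModule) r).symm
        | add s t hs ht =>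
          rw [smul_add]
          exact (congrArg₂ (· + ·) hs ht).trans
            (smul_add (A := (ρ.tprod (1 : Representation k M V)).asModule) r s t).symm
        | tmul u v => exact (Representation.smul_tprod_one_asModule ρ r u v).symm }
  exact Module.Projective.of_equiv F

/-- Averaging over `G_e` makes `k L̃_e ⊗_{kG_e} V` a direct summand of `k L̃_e ⊗_k V`. -/
theorem projective_lTildeTensor [NeZero (Nat.card (MaxSubgroup e) : k)]
    (h : Module.Projective k[M] (lTildeLeft e k).asModule) :
    Module.Projective k[M] (lTildeTensor e σ).asModule := by
  have : Finite (MaxSubgroup e) := Finite.of_injective _ MaxSubgroup.val_injective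
  have := Fintype.ofFinite (MaxSubgroup e)
  let f : (LTilde e →₀ k) ⊗[k] V →ₗ[k] (LTilde e →₀ k) ⊗[k] V :=
    (Nat.card (MaxSubgroup e) : k)⁻¹ • ∑ g : MaxSubgroup e,
      TensorProduct.map (lTildeRight e k (MulOpposite.op g)) (σ g⁻¹)
  have hf : ∀ u v, f (u ⊗ₜ v) = (Nat.card (MaxSubgroup e) : k)⁻¹ •
      ∑ g : MaxSubgroup e, lTildeRight e k (MulOpposite.op g) u ⊗ₜ[k] σ g⁻¹ v := by
    intro u v
    simp only [f, LinearMap.smul_apply, LinearMap.sum_apply, TensorProduct.map_tmul]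
  let π : ((lTildeLeft e k).tprod (1 : Representation k M V)).IntertwiningMap (lTildeTensor e σ) :=
    ⟨balancedMk (lTildeRight e k) σ, fun m => rfl⟩
  have hbal : ∀ u (h : MaxSubgroup e) v, f (lTildeRight e k (MulOpposite.op h) u ⊗ₜ v) =
      f (u ⊗ₜ σ h v) := by
    intro u h v
    rw [hf, hf]
    congr 1
    refine Fintype.sum_equiv (Equiv.mulLeft h) _ _ fun g => ?_
    rw [Equiv.coe_mulLeft, MulOpposite.op_mul, map_mul, mul_inv_rev, map_mul,
      Module.End.mul_apply, Module.End.mul_apply, ← Module.End.mul_apply (σ h⁻¹), ← map_mul,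
      inv_mul_cancel, map_one, Module.End.one_apply]
  let s' : BalancedTensor (lTildeRight e k) σ →ₗ[k] (LTilde e →₀ k) ⊗[k] V :=
    balancedLift (W := (LTilde e →₀ k) ⊗[k] V) (lTildeRight e k) σ f hbal
  have hs' : ∀ x v, s' (lTmul σ x v) = (Nat.card (MaxSubgroup e) : k)⁻¹ •
      ∑ g : MaxSubgroup e, Finsupp.single (MulOpposite.op g • x) 1 ⊗ₜ[k] σ g⁻¹ v := by
    intro x v
    refine (hf (Finsupp.single x 1) v).trans ?_
    simp only [lTildeRight_single]
  let s : (lTildeTensor e σ).IntertwiningMap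
      ((lTildeLeft e k).tprod (1 : Representation k M V)) := ⟨s', fun m => by
    refine lTildeTensor_hom_ext (W := (LTilde e →₀ k) ⊗[k] V) σ fun x v => ?_
    rw [LinearMap.comp_apply, LinearMap.comp_apply, hs', map_smul, map_sum]
    simp only [Representation.tprod_apply, TensorProduct.map_tmul]
    by_cases hx : LTildeRel (m * x.1) e
    · rw [lTildeTensor_lTmul σ hx, hs']
      congr 1
      refine Finset.sum_congr rfl fun g _ => ?_
      rw [lTildeLeft_single ((LTilde.mul_smul_iff _ _ _).mpr hx)]
      congr 2
      exact Subtype.ext (mul_assoc _ _ _)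
    · rw [lTildeTensor_lTmul_of_not σ hx, map_zero]
      refine (smul_eq_zero_of_right _ (Finset.sum_eq_zero fun g _ => ?_)).symm
      rw [lTildeLeft_single_of_not ((LTilde.mul_smul_iff _ _ _).not.mpr hx),
        TensorProduct.zero_tmul]⟩
  have hπs : balancedMk (lTildeRight e k) σ ∘ₗ s' = LinearMap.id := by
    refine lTildeTensor_hom_ext σ fun x v => ?_
    rw [LinearMap.comp_apply, hs', map_smul, map_sum]
    have hterm : ∀ g : MaxSubgroup e, balancedMk (lTildeRight e k) σ
        (Finsupp.single (MulOpposite.op g • x) 1 ⊗ₜ[k] σ g⁻¹ v) = lTmul σ x v := by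
      intro g
      change lTmul σ (MulOpposite.op g • x) (σ g⁻¹ v) = _
      rw [lTmul_smul, ← Module.End.mul_apply, ← map_mul, mul_inv_cancel, map_one,
        Module.End.one_apply]
    rw [Finset.sum_congr rfl fun g _ => hterm g, Finset.sum_const, Finset.card_univ,
      ← Nat.card_eq_fintype_card, ← Nat.cast_smul_eq_nsmul k, smul_smul,
      inv_mul_cancel₀ (NeZero.ne _), one_smul, LinearMap.id_apply]
  have := projective_tprod_one (lTildeLeft e k) h V
  exact Module.Projective.of_split
    (Representation.IntertwiningMap.equivLinearMapAsModule _ _ s)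
    (Representation.IntertwiningMap.equivLinearMapAsModule _ _ π)
    (LinearMap.ext fun t => LinearMap.congr_fun hπs t)

end Averaging

/-! ### Right invertible sandwich matrices make the graded module cyclic -/

section Cyclic

variable {M : Type u} [Monoid M] (k : Type v) [Field k]

/-- The span of the basis elements `y ∈ fM` with `f ∉ MyM`. -/
noncomputable def lowerSpan (f : M) : Submodule k (M →₀ k) :=
  Submodule.span k {z | ∃ y : M, f * y = y ∧ (¬ ∃ a b, f = a * y * b) ∧ z = Finsupp.single y 1}

variable {k}

theorem single_mem_lowerSpan {f y : M} (h : f * y = y) (h' : ¬ ∃ a b, f = a * y * b) (c : k) :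
    Finsupp.single y c ∈ lowerSpan k f := by
  rw [← Finsupp.smul_single_one]
  exact Submodule.smul_mem _ _ (Submodule.subset_span ⟨y, h, h', rfl⟩)

theorem lowerSpan_le {f : M} {T : Submodule k (M →₀ k)}
    (h : ∀ y, f * y = y → (¬ ∃ a b, f = a * y * b) → Finsupp.single y 1 ∈ T) :
    lowerSpan k f ≤ T := by
  refine Submodule.span_le.mpr ?_
  rintro _ ⟨y, hy, hy', rfl⟩
  exact h y hy hy'

/-- The linear map `kG_e → kM`, `g ↦ p g q`. -/
noncomputable def sandwichMap {e : Idem M} (p q : M) : k[MaxSubgroup e] →ₗ[k] (M →₀ k) :=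
  (Finsupp.lmapDomain k k fun g : MaxSubgroup e => p * g.val * q) ∘ₗ
    (MonoidAlgebra.coeffLinearEquiv k).toLinearMap

theorem sandwichMap_single {e : Idem M} (p q : M) (g : MaxSubgroup e) (c : k) :
    sandwichMap p q (MonoidAlgebra.single g c) = Finsupp.single (p * g.val * q) c :=
  Finsupp.mapDomain_single

theorem SandwichReps.lam_left_id {e : Idem M} (s : SandwichReps e) (b : LClassesIn e) :
    (e : M) * s.lam b = s.lam b := (s.lamR b).left_id

theorem SandwichReps.lRel_rho_mul_lam {e : Idem M} (s : SandwichReps e) (a : RClassesIn e)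
    (g : MaxSubgroup e) (b : LClassesIn e) : LRel (s.rho a * g.val * s.lam b) (s.lam b) := by
  obtain ⟨-, ⟨y, hy⟩⟩ := lRel_iff.mp (s.rho_LRel a)
  refine lRel_iff.mpr ⟨⟨s.rho a * g.val, rfl⟩, ⟨g⁻¹.val * y, ?_⟩⟩
  calc s.lam b = g⁻¹.val * g.val * s.lam b := by rw [g.inv_mul_val, s.lam_left_id]
    _ = g⁻¹.val * (e * g.val) * s.lam b := by rw [g.left_id]
    _ = _ := by rw [hy]; simp only [mul_assoc]

theorem LRel.trans {a b c : M} (h : LRel a b) (h' : LRel b c) : LRel a c := Eq.trans h h'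

theorem LRel.symm {a b : M} (h : LRel a b) : LRel b a := Eq.symm h

theorem JRel.trans {a b c : M} (h : JRel a b) (h' : JRel b c) : JRel a c := Eq.trans h h'

theorem JRel.symm {a b : M} (h : JRel a b) : JRel b a := Eq.symm h

/-- Translating `lam c • d ≡ lam c` to the idempotents of its `L`-class. -/
theorem gradedRep_idem_sub_mem {e : Idem M} (s : SandwichReps e) (d : M →₀ k)
    (hd : ∀ c, gradedRep k M (s.lam c) d - Finsupp.single (s.lam c) 1 ∈ lowerSpan k (e : M))
    {f : M} (hf : IsIdempotentElem f) (hfe : JRel f e) :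
    gradedRep k M f d - Finsupp.single f 1 ∈ lowerSpan k f := by
  let c : LClassesIn e := ⟨{x | LRel x f}, f, hfe, rfl⟩
  have hc : LRel (s.lam c) f := s.lam_mem c
  obtain ⟨-, ⟨u, hu⟩⟩ := lRel_iff.mp hc
  have hfu : f * u * s.lam c = f := by rw [mul_assoc, ← hu, hf]
  have h1 : LTildeRel (f * u * s.lam c) (s.lam c) := by rw [hfu]; exact hc.symm.lTildeRel
  have h2 : gradedRep k M f d - Finsupp.single f 1 =
      gradedRep k M (f * u) (gradedRep k M (s.lam c) d - Finsupp.single (s.lam c) 1) := by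
    rw [map_sub, gradedRep_single h1, ← Module.End.mul_apply, ← map_mul, hfu]
  rw [h2]
  refine lowerSpan_le (T := (lowerSpan k f).comap (gradedRep k M (f * u))) (fun y hy hy' => ?_)
    (hd c)
  rw [Submodule.mem_comap]
  by_cases hT : LTildeRel (f * u * y) y
  · rw [gradedRep_single hT]
    refine single_mem_lowerSpan (by rw [mul_assoc f, ← mul_assoc f f, hf]) ?_ 1
    rintro ⟨a, b, hab⟩
    obtain ⟨-, ⟨p, q, hpq⟩⟩ := jRel_iff.mp hfe
    exact hy' ⟨p * a * (f * u), b * q, hpq.trans (by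
      conv_lhs => rw [hab]
      simp only [mul_assoc])⟩
  · rw [gradedRep_single_of_not hT]
    exact zero_mem _

variable [Finite M]

/-- Modulo lower terms, `lam c` multiplies `ρ_a g lam_b` by the entry `(c, a)` of the sandwich
matrix. -/
theorem gradedRep_sandwichMap_sub_mem {e : Idem M} (s : SandwichReps e) (c b : LClassesIn e)
    (a : RClassesIn e) (z : k[MaxSubgroup e]) :
    gradedRep k M (s.lam c) (sandwichMap (s.rho a) (s.lam b) z) -
      sandwichMap 1 (s.lam b) (sandwichMatrix k s c a * z) ∈ lowerSpan k (e : M) := by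
  induction z using MonoidAlgebra.induction_linear with
  | zero => simp
  | add z z' h h' =>
    have := add_mem h h'
    rwa [← add_sub_add_comm, ← map_add, ← map_add, ← map_add, ← mul_add] at this
  | single g r =>
    rw [sandwichMap_single]
    by_cases hp : ∃ p : MaxSubgroup e, p.val = s.lam c * s.rho a
    · obtain ⟨p, hp⟩ := hp
      have heq : s.lam c * (s.rho a * g.val * s.lam b) = 1 * (p * g).val * s.lam b := by
        rw [MaxSubgroup.val_mul, hp, one_mul]; simp only [mul_assoc]
      have hL : LRel (1 * (p * g).val * s.lam b) (s.lam b) := by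
        refine lRel_iff.mpr ⟨⟨_, rfl⟩, ⟨(p * g)⁻¹.val, ?_⟩⟩
        rw [one_mul, ← mul_assoc, MaxSubgroup.inv_mul_val, s.lam_left_id]
      have hT : LTildeRel (s.lam c * (s.rho a * g.val * s.lam b)) (s.rho a * g.val * s.lam b) := by
        rw [heq]
        exact (hL.trans (s.lRel_rho_mul_lam a g b).symm).lTildeRel
      rw [gradedRep_single hT, sandwichMatrix_of_eq s hp, MonoidAlgebra.single_mul_single,
        sandwichMap_single, one_mul r, heq, sub_self]
      exact zero_mem _
    · rw [sandwichMatrix_of_not s hp, zero_mul, map_zero, sub_zero]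
      by_cases hT : LTildeRel (s.lam c * (s.rho a * g.val * s.lam b)) (s.rho a * g.val * s.lam b)
      · rw [gradedRep_single hT]
        refine single_mem_lowerSpan (by rw [← mul_assoc, s.lam_left_id]) (fun hJ => hp ?_) r
        refine exists_maxSubgroup_of_rRel (rRel_of_mul_left ?_ ?_) ?_
        · rw [← mul_assoc, s.lam_left_id]
        · obtain ⟨x, y, hxy⟩ := hJ
          exact ⟨x, g.val * s.lam b * y, by rw [hxy]; simp only [mul_assoc]⟩
        · rw [mul_assoc, s.rho_right_id]
      · rw [gradedRep_single_of_not hT]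
        exact zero_mem _

/-- Elements of `R_e` map the terms belonging to another `J`-class to lower terms. -/
theorem gradedRep_sandwichMap_mem {e f : Idem M} (hef : ¬ JRel (e : M) f) (s : SandwichReps f)
    {r : M} (hr : RRel r e) (a : RClassesIn f) (b : LClassesIn f) (z : k[MaxSubgroup f]) :
    gradedRep k M r (sandwichMap (s.rho a) (s.lam b) z) ∈ lowerSpan k (e : M) := by
  induction z using MonoidAlgebra.induction_linear with
  | zero => simp
  | add z z' h h' => rw [map_add, map_add]; exact add_mem h h'
  | single g c =>
    rw [sandwichMap_single]
    by_cases hT : LTildeRel (r * (s.rho a * g.val * s.lam b)) (s.rho a * g.val * s.lam b)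
    · rw [gradedRep_single hT]
      have her : (e : M) * r = r := RClass.left_id ⟨r, hr⟩
      refine single_mem_lowerSpan (by rw [← mul_assoc, her]) (fun hJ => hef ?_) c
      -- A term of the `J`-class of `e` would be regular, hence `L`-related to `lam b`.
      have hR : RRel (r * (s.rho a * g.val * s.lam b)) e :=
        rRel_of_mul_left (by rw [← mul_assoc, her]) hJ
      obtain ⟨y, -, -, hy⟩ := hR.exists_regular e.2
      obtain ⟨y', -, -, hy'⟩ := (s.lam_RRel b).exists_regular f.2
      have hL := (hT.trans (s.lRel_rho_mul_lam a g b).lTildeRel).lRel_of_regular_of_regular hy hy'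
      exact hR.jRel.symm.trans (hL.jRel.trans (s.lam_RRel b).jRel)
    · rw [gradedRep_single_of_not hT]
      exact zero_mem _

noncomputable instance (e : Idem M) : Fintype (LClassesIn e) := Fintype.ofFinite _

/-- Given right inverses of the sandwich matrices, there is `d` in the graded module with
`lam c • d ≡ lam c` modulo lower terms for all `c`. -/
theorem exists_approximate_generator {ι : Type*} [Fintype ι] (e : ι → Idem M)
    (he : ∀ i j, JRel (e i : M) (e j) → i = j) (s : ∀ i, SandwichReps (e i))
    (h : ∀ i, IsRightInvertible (sandwichMatrix k (s i))) :
    ∃ d : M →₀ k, ∀ i c, gradedRep k M ((s i).lam c) d - Finsupp.single ((s i).lam c) 1 ∈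
      lowerSpan k (e i : M) := by
  classical
  choose Q hQ using h
  let d : ι → M →₀ k := fun i => ∑ b, ∑ a, sandwichMap ((s i).rho a) ((s i).lam b) (Q i a b)
  refine ⟨∑ i, d i, fun i c => ?_⟩
  have hne : ∀ j ≠ i, gradedRep k M ((s i).lam c) (d j) ∈ lowerSpan k (e i : M) := by
    intro j hj
    simp only [d, map_sum]
    exact sum_mem fun b _ => sum_mem fun a _ =>
      gradedRep_sandwichMap_mem (fun hJ => hj (he i j hJ).symm) (s j) ((s i).lam_RRel c) a b _
  have heq : gradedRep k M ((s i).lam c) (d i) - Finsupp.single ((s i).lam c) 1 ∈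
      lowerSpan k (e i : M) := by
    have h1 : (Finsupp.single ((s i).lam c) 1 : M →₀ k) = ∑ b, ∑ a,
        sandwichMap 1 ((s i).lam b) (sandwichMatrix k (s i) c a * Q i a b) := by
      have h2 : ∀ b, ∑ a, sandwichMap (k := k) 1 ((s i).lam b)
          (sandwichMatrix k (s i) c a * Q i a b) =
            if c = b then Finsupp.single ((s i).lam c) 1 else 0 := by
        intro b
        rw [← map_sum, ← Matrix.mul_apply, hQ, Matrix.one_apply]
        split_ifs with hcb
        · rw [MonoidAlgebra.one_def, sandwichMap_single, one_mul, MaxSubgroup.val_one,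
            (s i).lam_left_id, hcb]
        · rw [map_zero]
      simp only [h2, Finset.sum_ite_eq, Finset.mem_univ, if_true]
    rw [h1]
    simp only [d, map_sum, ← Finset.sum_sub_distrib]
    exact sum_mem fun b _ => sum_mem fun a _ => gradedRep_sandwichMap_sub_mem (s i) c b a _
  rw [map_sum, ← Finset.add_sum_erase _ _ (Finset.mem_univ i), add_sub_right_comm]
  exact add_mem heq (sum_mem fun j hj => hne j (Finset.ne_of_mem_erase hj))

/-- If `x` is `L̃`-related to `f` and `y ∈ fM` with `f ∉ MyM`, then `xyM` is strictly contained
in `xM`: otherwise `x` would be fixed by an idempotent power of some `yw`. -/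
theorem not_mul_mul_eq {f x y w : M} (hx : LTildeRel x f)
    (hfy : f * y = y) (hy : ¬ ∃ a b, f = a * y * b) : x * y * w ≠ x := by
  intro h
  obtain ⟨n, hn, hE⟩ := exists_isIdempotentElem_pow (y * w)
  have hpow : ∀ n, x * (y * w) ^ n = x := by
    intro n
    induction n with
    | zero => simp
    | succ n ih => rw [pow_succ', ← mul_assoc, ← mul_assoc, h, ih]
  have hf := (hx _ hE).mp (hpow n)
  obtain ⟨m, rfl⟩ := Nat.exists_eq_succ_of_ne_zero hn.ne'
  refine hy ⟨1, w * (y * w) ^ m, ?_⟩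
  rw [one_mul]
  conv_lhs => rw [← hf, Nat.succ_eq_add_one, pow_succ', ← mul_assoc, ← mul_assoc, hfy]
  simp only [mul_assoc]

/-- An element `d` with `f • d ≡ f` modulo lower terms for all idempotents `f` generates the
graded module. -/
theorem orbitHom_gradedRep_surjective [IsRightFountain M] (d : M →₀ k)
    (hd : ∀ f : M, IsIdempotentElem f →
      gradedRep k M f d - Finsupp.single f 1 ∈ lowerSpan k f) :
    Function.Surjective (orbitHom (gradedRep k M) d) := by
  let T : Submodule k (M →₀ k) :=
    LinearMap.range (LinearMap.applyₗ d ∘ₗ (gradedRep k M).asAlgebraHom.toLinearMap)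
  have hTd : ∀ m, gradedRep k M m d ∈ T := fun m =>
    ⟨MonoidAlgebra.single m 1, by
      change (gradedRep k M).asAlgebraHom _ d = _
      rw [Representation.asAlgebraHom_single, one_smul]⟩
  have key : ∀ (n : ℕ) (x : M), Set.ncard {y | ∃ a, y = x * a} = n → Finsupp.single x 1 ∈ T := by
    intro n
    induction n using Nat.strong_induction_on with
    | _ n ih =>
    intro x hn
    obtain ⟨f, hf, hfx⟩ := IsRightFountain.exists_idem x
    have hxf : x * f = x := (hfx f hf).mp hf
    have h1 : gradedRep k M x (Finsupp.single f 1) = Finsupp.single x (1 : k) := by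
      have h : LTildeRel (x * f) f := by rw [hxf]; exact hfx.symm
      rw [gradedRep_single h, hxf]
    have h2 : gradedRep k M x (gradedRep k M f d - Finsupp.single f 1) ∈ T := by
      refine lowerSpan_le (T := T.comap (gradedRep k M x)) (fun y hy hy' => ?_) (hd f hf)
      rw [Submodule.mem_comap]
      by_cases hT : LTildeRel (x * y) y
      · rw [gradedRep_single hT]
        refine ih _ (hn ▸ Set.ncard_lt_ncard ⟨?_, fun hsub => ?_⟩ (Set.toFinite _)) _ rfl
        · rintro _ ⟨a, rfl⟩
          exact ⟨y * a, mul_assoc x y a⟩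
        · obtain ⟨w, hw⟩ := @hsub x ⟨1, (mul_one x).symm⟩
          exact not_mul_mul_eq hfx.symm hy hy' hw.symm
      · rw [gradedRep_single_of_not hT]
        exact zero_mem _
    rw [map_sub, h1, ← Module.End.mul_apply, ← map_mul, hxf] at h2
    have := T.sub_mem (hTd x) h2
    rwa [sub_sub_cancel] at this
  intro (y : M →₀ k)
  have hy : y ∈ T := by
    induction y using Finsupp.induction_linear with
    | zero => exact zero_mem _
    | add y z hy hz => exact add_mem hy hz
    | single x c =>
      rw [← Finsupp.smul_single_one]
      exact Submodule.smul_mem _ _ (key _ x rfl)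
  exact hy

end Cyclic

/-- Each idempotent of a finite monoid has a choice of representatives for the sandwich matrix. -/
theorem nonempty_sandwichReps {M : Type u} [Monoid M] [Finite M] (e : Idem M) :
    Nonempty (SandwichReps e) := by
  have hA : ∀ a : RClassesIn e, ∃ x, x ∈ a.1 ∧ LRel x e := by
    rintro ⟨_, m, hm, rfl⟩
    obtain ⟨⟨p, q, hpq⟩, ⟨p', q', hpq'⟩⟩ := jRel_iff.mp hm
    have h1 : RRel (p * e) m := by
      obtain ⟨z, hz⟩ := right_stable (a := m) (b := p * e) ⟨q, hpq⟩
        ⟨p * p', q', by rw [mul_assoc p, mul_assoc p, ← hpq']⟩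
      exact rRel_iff.mpr ⟨⟨z, hz⟩, ⟨q, hpq⟩⟩
    refine ⟨p * e, h1, lRel_of_mul_right (by rw [mul_assoc, e.2]) ⟨p', q * q', hpq'.trans ?_⟩⟩
    rw [hpq]; simp only [mul_assoc]
  have hB : ∀ b : LClassesIn e, ∃ x, x ∈ b.1 ∧ RRel x e := by
    rintro ⟨_, m, hm, rfl⟩
    obtain ⟨⟨p, q, hpq⟩, ⟨p', q', hpq'⟩⟩ := jRel_iff.mp hm
    have h1 : LRel (e * q) m := by
      obtain ⟨z, hz⟩ := left_stable (a := m) (b := e * q) ⟨p, by rw [hpq, mul_assoc]⟩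
        ⟨p', q' * q, by rw [← mul_assoc, ← hpq']⟩
      exact lRel_iff.mpr ⟨⟨z, hz⟩, ⟨p, by rw [hpq, mul_assoc]⟩⟩
    refine ⟨e * q, h1, rRel_of_mul_left (by rw [← mul_assoc, e.2]) ⟨p' * p, q', hpq'.trans ?_⟩⟩
    rw [hpq]; simp only [mul_assoc]
  choose rho hrho using hA
  choose lam hlam using hB
  exact ⟨⟨rho, fun a => (hrho a).1, fun a => (hrho a).2, lam, fun b => (hlam b).1,
    fun b => (hlam b).2⟩⟩

/-- Right invertibility of the sandwich matrices implies that all modules `k L̃_f ⊗ V` are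
projective. -/
theorem projective_of_isRightInvertible {M : Type u} [Monoid M] [Finite M] [IsRightFountain M]
    {k : Type v} [Field k] {ι : Type*} [Fintype ι] (e : ι → Idem M)
    (he : ∀ f : Idem M, ∃! i, JRel (f : M) (e i))
    (h : ∀ (i : ι) (s : SandwichReps (e i)), IsRightInvertible (sandwichMatrix k s))
    (f : Idem M) [NeZero (Nat.card (MaxSubgroup f) : k)] {V : Type w} [AddCommGroup V] [Module k V]
    (σ : Representation k (MaxSubgroup f) V) :
    Module.Projective k[M] (lTildeTensor f σ).asModule := by
  have hs := fun i => nonempty_sandwichReps (e i)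
  let s : ∀ i, SandwichReps (e i) := fun i => (hs i).some
  obtain ⟨d, hd⟩ := exists_approximate_generator (k := k) e
    (fun i j hij => (he (e i)).unique rfl hij) s fun i => h i (s i)
  refine projective_lTildeTensor σ (projective_lTildeLeft f
    (projective_gradedRep_of_cyclic d (orbitHom_gradedRep_surjective d fun f hf => ?_)))
  obtain ⟨i, hi⟩ := (he ⟨f, hf⟩).exists
  exact gradedRep_idem_sub_mem (s i) d (hd i) hf hi

end FountainMonoid

theorem theoremt {M : Type u} [Monoid M] [Finite M] [FountainMonoid.IsRightFountain M]
    {k : Type v} [Field k]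
    (hchar : ∀ f : FountainMonoid.Idem M,
      ¬ ringChar k ∣ Nat.card (FountainMonoid.MaxSubgroup f))
    (n : ℕ) (e : Fin n → FountainMonoid.Idem M)
    (he : ∀ f : FountainMonoid.Idem M, ∃! i : Fin n, FountainMonoid.JRel (f : M) (e i : M)) :
    List.TFAE [
      ∀ (i : Fin n) (s : FountainMonoid.SandwichReps (e i)),
        FountainMonoid.IsRightInvertible (FountainMonoid.sandwichMatrix k s),
      ∀ (i : Fin n) (V : Type (max u v)) [AddCommGroup V] [Module k V]
        (σ : Representation k (FountainMonoid.MaxSubgroup (e i)) V), σ.IsIrreducible →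
        (FountainMonoid.coind (e i) σ).IsIrreducible,
      ∀ (i : Fin n) (V : Type (max u v)) [AddCommGroup V] [Module k V]
        (σ : Representation k (FountainMonoid.MaxSubgroup (e i)) V), σ.IsIrreducible →
        FountainMonoid.IsProjectiveCover k[M] (FountainMonoid.lTildeTensor (e i) σ).asModule
          (FountainMonoid.sharp (e i) σ)] := by
  have hne : ∀ f : FountainMonoid.Idem M,
      NeZero (Nat.card (FountainMonoid.MaxSubgroup f) : k) := fun f =>
    ⟨fun h => hchar f ((ringChar.spec k _).mp h)⟩
  tfae_have 1 → 3 := by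
    intro h i V _ _ σ hσ
    have := hne (e i)
    exact (FountainMonoid.isProjectiveCover_iff σ).mpr
      (FountainMonoid.projective_of_isRightInvertible e he h (e i) σ)
  tfae_have 3 → 2 := by
    intro h i V _ _ σ hσ
    refine (FountainMonoid.coind_isIrreducible_iff σ).mpr ?_
    exact FountainMonoid.headMap_surjective_of_projective e (fun i => hne (e i)) he
      (fun i V _ _ σ hσ => (FountainMonoid.isProjectiveCover_iff σ).mp (h i V σ hσ)) i σ
  tfae_have 2 → 1 := by
    intro h i s
    have := hne (e i)
    exact FountainMonoid.isRightInvertible_of_surjective s fun V _ _ σ hσ =>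
      (FountainMonoid.coind_isIrreducible_iff σ).mp (h i V σ hσ)
  tfae_finish
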